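/- **Setting.** Let $\mathbb R[\mathbf x]=\mathbb R[x_1,\dots,x_n]$, let $h_1,\dots,h_m\in\mathbb R[\mathbf x]$, $I=(h_1,\dots,h_m)$, $D=\max_j\deg h_j$, $V_{\mathbb R}(I)\subseteq\mathbb R^n$ the set of real common zeros of $I$, $I(V_{\mathbb R}(I))$ its vanishing ideal, and, for an ideal $K$ of $\mathbb R[\mathbf x]$, $$\sqrt[\mathbb R]{K}=\Big\{p : p^{2k}+\sum_j q_j^2\in K\text{ for some }k\ge 1,\ q_j\in\mathbb R[\mathbf x]\Big\};$$ $K$ is real radical if $K=\sqrt[\mathbb R]K$. Let $\mathbb R[\mathbf x]_r$ be the space of polynomials of degree at most $r$, $\mathbb N^n_r=\{\alpha\in\mathbb N^n:|\alpha|\le r\}$, and $\mathbb T^n_r=\{\mathbf x^\alpha:\alpha\in\mathbb N^n_r\}$. Let $\pi_r$ denote restriction of linear forms to $\mathbb R[\mathbf x]_r$. For $L\in(\mathbb R[\mathbf x]_t)^*$ and $2r\le t$, let $M_r(L)=(L(\mathbf x^{\alpha+\beta}))_{\alpha,\beta\in\mathbb N^n_r}$, and regard $\operatorname{Ker}M_r(L)$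 as a subset of $\mathbb R[\mathbf x]_r$ via coefficient vectors. Put $$\mathcal H_t=\{\mathbf x^\alpha h_j:|\alpha|+\deg h_j\le t\},\qquad \mathcal K_{t,\succeq}=\{L\in(\mathbb R[\mathbf x]_t)^*: L(p)=0\ \forall p\in\mathcal H_t,\ M_{\lfloor t/2\rfloor}(L)\succeq0\}.$$ An element $L^*\in\mathcal K_{t,\succeq}$ is generic if $\operatorname{rank}M_{\lfloor t/2\rfloor}(L^*)$ is maximal over $\mathcal K_{t,\succeq}$; all generic elements have the same kernel $\mathcal N_t=\operatorname{Ker}M_{\lfloor t/2\rfloor}(L^*)$. Let $$\mathcal G_t=\mathcal H_t\cup\{\mathbf x^\alpha g:|\alpha|\le\lfloor t/2\rfloor,\ g\in\mathcal N_t\},\qquad \mathcal G_t^+=\mathcal G_t\cup x_1\mathcal G_t\cup\dots\cup x_n\mathcal G_t,$$ and let $\mathcal G_t^\perp\subseteq(\mathbb R[\mathbf x]_t)^*$, $(\mathcal G_t^+)^\perp\subseteq(\mathbb R[\mathbf x]_{t+1})^*$ be the spaces of linear forms vanishing on these sets. A set $\mathcal B$ of monomials is connected to 1 if every element of $\mathcal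 B$ can be reached from $1$ by multiplying by one variable at a time, with all intermediate products, including $1$, in $\mathcal B$. Its border is $\partial\mathcal B=(\mathcal B\cup x_1\mathcal B\cup\dots\cup x_n\mathcal B)\setminus\mathcal B$ if $\mathcal B\neq\emptyset$, and $\partial\emptyset=\{1\}$. For $r\ge0$ consider the decomposition $$\mathbb R[\mathbf x]_r=\operatorname{Span}_{\mathbb R}(\mathcal B)\oplus\big(\mathbb R[\mathbf x]_r\cap\operatorname{Span}_{\mathbb R}(\mathcal G_t)\big).\tag{$*_r$}$$ For $r\ge1$ and $\mathcal B\subseteq\mathbb T^n_{r-1}$ connected to 1 and satisfying $(*_r)$, let $\varphi$ be the projection of $\mathbb R[\mathbf x]_r$ onto $\operatorname{Span}_{\mathbb R}(\mathcal B)$ along $\mathbb R[\mathbf x]_r\cap\operatorname{Span}_{\mathbb R}(\mathcal G_t)$, and let $J_r(\mathcal B)$ be the ideal generated by $\{m-\varphi(m):m\in\partial\mathcal B\}$. **Proposition 4.3.** Let $L^*$ be a generic element of $\mathcal K_{t,\succeq}$ and $1\le s\le\lfloor t/2\rfloor$. Consider the conditions $$\text{(R)}\ \operatorname{rank}M_s(L^*)=\operatorname{rank}M_{s-1}(L^*),$$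 $$\text{(a)}\ \dim\pi_{2s}(\mathcal G_t^\perp)=\dim\pi_{s-1}(\mathcal G_t^\perp),\qquad \text{(b)}\ \dim\pi_{2s}(\mathcal G_t^\perp)=\dim\pi_{2s}((\mathcal G_t^+)^\perp).$$ (i) If (R) holds, then (a) holds, and (b) holds as well if $s\ge D$. (ii) If (a) and (b) hold, then (R) holds, and there is an ideal $J$ with the following properties. * For each $r\in\{s,2s\}$ there is a set $\mathcal B\subseteq\mathbb T^n_{r-1}$ closed under taking divisions and satisfying $(*_r)$, and $J_r(\mathcal B)=J$ for every $\mathcal B\subseteq\mathbb T^n_{r-1}$ connected to 1 and satisfying $(*_r)$. * $J$ is real radical, and $J=(\operatorname{Ker}M_s(L^*))\subseteq I(V_{\mathbb R}(I))$. * A set $\mathcal B\subseteq\mathbb T^n_{s-1}$ satisfies $(*_{s-1})$ if and only if it indexes a column basis of $M_{s-1}(L^*)$. * If $s\ge D$, then $J=\sqrt[\mathbb R]I$. -/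

import Mathlib

open MvPolynomial

noncomputable section

namespace MomentProlongation

/-- `ℝ[x]_t`: real polynomials in `n` variables of total degree at most `t`. -/
abbrev Poly (n t : ℕ) : Submodule ℝ (MvPolynomial (Fin n) ℝ) :=
  restrictTotalDegree (Fin n) ℝ t

theorem poly_mono {n r t : ℕ} (hrt : r ≤ t) : Poly n r ≤ Poly n t := by
  intro p hp
  rw [mem_restrictTotalDegree] at hp ⊢
  exact hp.trans hrt

/-- The set `ℕⁿ_t` of exponents of degree at most `t`; it indexes the monomials `𝕋ⁿ_t`. -/
abbrev Expo (n t : ℕ) : Type := {α : Fin n →₀ ℕ // α.degree ≤ t}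

instance (n t : ℕ) : Finite (Expo n t) :=
  Finite.of_injective
    (fun (α : Expo n t) (i : Fin n) =>
      (⟨α.1 i, Nat.lt_succ_of_le ((Finsupp.le_degree i α.1).trans α.2)⟩ : Fin (t + 1)))
    (by
      intro α β hαβ
      apply Subtype.ext
      ext i
      exact congrArg Fin.val (congrFun hαβ i))

instance (n t : ℕ) : Fintype (Expo n t) := Fintype.ofFinite _

theorem monomial_mem_poly {n t : ℕ} {α : Fin n →₀ ℕ} (hα : α.degree ≤ t) :
    monomial α (1 : ℝ) ∈ Poly n t := by
  rw [mem_restrictTotalDegree]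
  exact (totalDegree_monomial_le _ _).trans hα

theorem add_mem_poly {n s t : ℕ} (hst : 2 * s ≤ t) (α β : Expo n s) :
    monomial (α.1 + β.1) (1 : ℝ) ∈ Poly n t := by
  apply monomial_mem_poly
  have h1 := α.2
  have h2 := β.2
  rw [map_add]
  omega

/-! ### Linear forms on truncated polynomial spaces -/

/-- The projection `π_r : (ℝ[x]_t)^* → (ℝ[x]_r)^*` (restriction of linear forms), `r ≤ t`. -/
def proj {n r t : ℕ} (hrt : r ≤ t) :
    Module.Dual ℝ (Poly n t) →ₗ[ℝ] Module.Dual ℝ (Poly n r) :=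
  (Submodule.inclusion (poly_mono hrt)).dualMap

/-- `G^⊥ ⊆ (ℝ[x]_t)^*` for a set `G ⊆ ℝ[x]_t`. -/
def perp {n : ℕ} (t : ℕ) (G : Set (MvPolynomial (Fin n) ℝ)) :
    Submodule ℝ (Module.Dual ℝ (Poly n t)) where
  carrier := {L | ∀ p : Poly n t, (p : MvPolynomial (Fin n) ℝ) ∈ G → L p = 0}
  zero_mem' := by
    intro p _
    rfl
  add_mem' := by
    intro L L' hL hL' p hp
    simp [hL p hp, hL' p hp]
  smul_mem' := by
    intro c L hL p hp
    simp [hL p hp]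

/-- `dim π_r(G^⊥)`, the orthogonal being taken in `(ℝ[x]_t)^*`. -/
def dimProj {n r t : ℕ} (hrt : r ≤ t) (G : Set (MvPolynomial (Fin n) ℝ)) : ℕ :=
  Module.finrank ℝ ((perp t G).map (proj hrt))

/-- The one degree prolongation `G⁺ = G ∪ x₁G ∪ … ∪ xₙG`. -/
def prolong {n : ℕ} (G : Set (MvPolynomial (Fin n) ℝ)) : Set (MvPolynomial (Fin n) ℝ) :=
  G ∪ {p | ∃ i : Fin n, ∃ q ∈ G, p = X i * q}

/-! ### Moment matrices -/

/-- The moment matrix `M_s(L) = (L(x^α x^β))_{α, β ∈ ℕⁿ_s}` of a linear form `L` on `ℝ[x]_t`. -/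
def momentMatrix {n s t : ℕ} (hst : 2 * s ≤ t) (L : Module.Dual ℝ (Poly n t)) :
    Matrix (Expo n s) (Expo n s) ℝ :=
  Matrix.of fun α β => L ⟨monomial (α.1 + β.1) 1, add_mem_poly hst α β⟩

/-- The coefficient vector `vec(p)`, restricted to the exponents in `ℕⁿ_s`. -/
def vec (n s : ℕ) : MvPolynomial (Fin n) ℝ →ₗ[ℝ] (Expo n s → ℝ) :=
  LinearMap.pi fun α => lcoeff ℝ α.1

/-- `Ker M_s(L)`, viewed as a set of polynomials in `ℝ[x]_s`. -/
def momentKer {n s t : ℕ} (hst : 2 * s ≤ t) (L : Module.Dual ℝ (Poly n t)) :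
    Submodule ℝ (MvPolynomial (Fin n) ℝ) :=
  Poly n s ⊓ LinearMap.ker ((momentMatrix hst L).mulVecLin ∘ₗ vec n s)

/-- `B ⊆ 𝕋ⁿ_s` indexes a column basis of `M_s(L)`: the columns indexed by `B` are linearly
independent (as a family) and span the column space. -/
def IsColumnBasis {n s t : ℕ} (hst : 2 * s ≤ t) (L : Module.Dual ℝ (Poly n t))
    (B : Set (Fin n →₀ ℕ)) : Prop :=
  LinearIndependent ℝ (fun b : {b : Expo n s // b.1 ∈ B} => (momentMatrix hst L).col b.1) ∧
  Submodule.span ℝ ((momentMatrix hst L).col '' {b : Expo n s | b.1 ∈ B}) =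
    Submodule.span ℝ (Set.range (momentMatrix hst L).col)

/-! ### The cone of positive linear forms and the system `G_t` -/

/-- `H_t = {x^α h_j : |α| + deg h_j ≤ t}`. -/
def prolongations {n m : ℕ} (h : Fin m → MvPolynomial (Fin n) ℝ) (t : ℕ) :
    Set (MvPolynomial (Fin n) ℝ) :=
  {p | ∃ (α : Fin n →₀ ℕ) (j : Fin m),
    α.degree + (h j).totalDegree ≤ t ∧ p = monomial α 1 * h j}

/-- The cone `K_{t,⪰}` of those `L ∈ H_t^⊥` with `M_{⌊t/2⌋}(L) ⪰ 0`. -/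
def posCone {n m : ℕ} (h : Fin m → MvPolynomial (Fin n) ℝ) (t : ℕ) :
    Set (Module.Dual ℝ (Poly n t)) :=
  {L | L ∈ perp t (prolongations h t) ∧ (momentMatrix (Nat.mul_div_le t 2) L).PosSemidef}

/-- `L` is a generic element of `K_{t,⪰}`: `rank M_{⌊t/2⌋}` is maximal at `L`. -/
def IsGeneric {n m : ℕ} (h : Fin m → MvPolynomial (Fin n) ℝ) (t : ℕ)
    (L : Module.Dual ℝ (Poly n t)) : Prop :=
  L ∈ posCone h t ∧ ∀ L' ∈ posCone h t,
    (momentMatrix (Nat.mul_div_le t 2) L').rank ≤ (momentMatrix (Nat.mul_div_le t 2) L).rank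

/-- `N_t`, the common kernel `Ker M_{⌊t/2⌋}(L)` of the generic elements `L` of `K_{t,⪰}`
(see `genericKer_eq`). -/
def genericKer {n m : ℕ} (h : Fin m → MvPolynomial (Fin n) ℝ) (t : ℕ) :
    Set (MvPolynomial (Fin n) ℝ) :=
  {p | ∀ L, IsGeneric h t L → p ∈ momentKer (Nat.mul_div_le t 2) L}

theorem posCone_add {n m : ℕ} {h : Fin m → MvPolynomial (Fin n) ℝ} {t : ℕ}
    {L L' : Module.Dual ℝ (Poly n t)} (hL : L ∈ posCone h t) (hL' : L' ∈ posCone h t) :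
    L + L' ∈ posCone h t :=
  ⟨Submodule.add_mem _ hL.1 hL'.1, by
    have he : momentMatrix (Nat.mul_div_le t 2) (L + L') =
        momentMatrix (Nat.mul_div_le t 2) L + momentMatrix (Nat.mul_div_le t 2) L' := by
      ext α β
      simp [momentMatrix]
    rw [he]
    exact hL.2.add hL'.2⟩

/-- Generic elements have the smallest kernel in the cone. -/
theorem IsGeneric.momentKer_le {n m : ℕ} {h : Fin m → MvPolynomial (Fin n) ℝ} {t : ℕ}
    {L L' : Module.Dual ℝ (Poly n t)} (hL : IsGeneric h t L) (hL' : L' ∈ posCone h t) :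
    momentKer (Nat.mul_div_le t 2) L ≤ momentKer (Nat.mul_div_le t 2) L' := by
  have hr := hL.2 _ (posCone_add hL.1 hL')
  have he : momentMatrix (Nat.mul_div_le t 2) (L + L') =
      momentMatrix (Nat.mul_div_le t 2) L + momentMatrix (Nat.mul_div_le t 2) L' := by
    ext α β
    simp [momentMatrix]
  rw [he] at hr
  have hA := hL.1.2
  have hB := hL'.2
  rw [momentKer, momentKer]
  generalize momentMatrix (Nat.mul_div_le t 2) L = A at hr hA ⊢
  generalize momentMatrix (Nat.mul_div_le t 2) L' = B at hr hB ⊢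
  have key : ∀ x, (A + B).mulVec x = 0 → A.mulVec x = 0 ∧ B.mulVec x = 0 := by
    intro x hx
    have h0 : star x ⬝ᵥ A.mulVec x + star x ⬝ᵥ B.mulVec x = 0 := by
      rw [← dotProduct_add, ← Matrix.add_mulVec, hx, dotProduct_zero]
    have h1 := hA.dotProduct_mulVec_nonneg x
    have h2 := hB.dotProduct_mulVec_nonneg x
    exact ⟨(hA.dotProduct_mulVec_zero_iff x).1 (by linarith),
      (hB.dotProduct_mulVec_zero_iff x).1 (by linarith)⟩
  have hle : LinearMap.ker (A + B).mulVecLin ≤ LinearMap.ker A.mulVecLin := by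
    intro x hx
    exact (key x hx).1
  have heq : LinearMap.ker (A + B).mulVecLin = LinearMap.ker A.mulVecLin := by
    apply Submodule.eq_of_le_of_finrank_le hle
    have e1 := LinearMap.finrank_range_add_finrank_ker (A + B).mulVecLin
    have e2 := LinearMap.finrank_range_add_finrank_ker A.mulVecLin
    have e3 : Module.finrank ℝ (LinearMap.range (A + B).mulVecLin) ≤
        Module.finrank ℝ (LinearMap.range A.mulVecLin) := hr
    omega
  intro p hp
  refine ⟨hp.1, ?_⟩
  have hx : vec n (t / 2) p ∈ LinearMap.ker A.mulVecLin := hp.2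
  rw [← heq] at hx
  exact (key _ hx).2

/-- `N_t` is the kernel of `M_{⌊t/2⌋}(L)` for any one generic element `L`. -/
theorem genericKer_eq {n m : ℕ} {h : Fin m → MvPolynomial (Fin n) ℝ} {t : ℕ}
    {L : Module.Dual ℝ (Poly n t)} (hL : IsGeneric h t L) :
    genericKer h t = momentKer (Nat.mul_div_le t 2) L :=
  Set.Subset.antisymm (fun _ hp => hp L hL) (fun _ hp _ hL' => hL.momentKer_le hL'.1 hp)

/-- `G_t = H_t ∪ W_t`, where `W_t = {x^α g : |α| ≤ ⌊t/2⌋, g ∈ N_t}`. -/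
def system {n m : ℕ} (h : Fin m → MvPolynomial (Fin n) ℝ) (t : ℕ) :
    Set (MvPolynomial (Fin n) ℝ) :=
  prolongations h t ∪
    {p | ∃ (α : Fin n →₀ ℕ) (g : MvPolynomial (Fin n) ℝ),
      α.degree ≤ t / 2 ∧ g ∈ genericKer h t ∧ p = monomial α 1 * g}

/-! ### Sets of monomials and the ideal `J` -/

/-- `Span_ℝ(B)` for a set `B` of monomials, given by exponents. -/
def monoSpan {n : ℕ} (B : Set (Fin n →₀ ℕ)) : Submodule ℝ (MvPolynomial (Fin n) ℝ) :=
  Submodule.span ℝ ((fun α => monomial α (1 : ℝ)) '' B)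

/-- `B ⊆ 𝕋ⁿ_r`. -/
def DegreeLE {n : ℕ} (B : Set (Fin n →₀ ℕ)) (r : ℕ) : Prop := ∀ α ∈ B, α.degree ≤ r

/-- `B` is closed under taking divisions. -/
def DivisionClosed {n : ℕ} (B : Set (Fin n →₀ ℕ)) : Prop := ∀ α ∈ B, ∀ β, β ≤ α → β ∈ B

/-- `B` is connected to 1: each of its monomials is reached from `1` by multiplying with one
variable at a time and staying in `B`. -/
def ConnectedToOne {n : ℕ} (B : Set (Fin n →₀ ℕ)) : Prop :=
  ∀ α ∈ B, ∃ (k : ℕ) (c : ℕ → (Fin n →₀ ℕ)), c 0 = 0 ∧ c k = α ∧ (∀ l ≤ k, c l ∈ B) ∧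
    ∀ l < k, ∃ i : Fin n, c (l + 1) = c l + Finsupp.single i 1

/-- The border `∂B = B⁺ \ B`, with the usual convention `∂∅ = {1}`. (A nonempty set connected
to 1 contains 1, so that the additional element `1` matters for `B = ∅` only.) -/
def border {n : ℕ} (B : Set (Fin n →₀ ℕ)) : Set (Fin n →₀ ℕ) :=
  ({0} ∪ {α | ∃ i : Fin n, ∃ β ∈ B, α = β + Finsupp.single i 1}) \ B

/-- The direct sum decomposition `ℝ[x]_r = Span(B) ⊕ (ℝ[x]_r ∩ Span(G))`. -/
def Decomposes {n : ℕ} (G : Set (MvPolynomial (Fin n) ℝ)) (r : ℕ)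
    (B : Set (Fin n →₀ ℕ)) : Prop :=
  Disjoint (monoSpan B) (Poly n r ⊓ Submodule.span ℝ G) ∧
  monoSpan B ⊔ (Poly n r ⊓ Submodule.span ℝ G) = Poly n r

/-- `F₀ = {m - φ(m) : m ∈ ∂B}`, where `φ` is the projection from `ℝ[x]_r` onto `Span(B)` along
`ℝ[x]_r ∩ Span(G)`: `φ(m)` is the unique `q ∈ Span(B)` with `m - q ∈ ℝ[x]_r ∩ Span(G)`. -/
def borderFamily {n : ℕ} (G : Set (MvPolynomial (Fin n) ℝ)) (r : ℕ)
    (B : Set (Fin n →₀ ℕ)) : Set (MvPolynomial (Fin n) ℝ) :=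
  {f | ∃ α ∈ border B, ∃ q ∈ monoSpan B,
    f = monomial α 1 - q ∧ f ∈ Poly n r ⊓ Submodule.span ℝ G}

/-- `J` is the ideal obtained from `G` at order `r`: there is a set `B ⊆ 𝕋ⁿ_{r-1}`, closed under
taking divisions, that decomposes `ℝ[x]_r`, and `J = (F₀)` for every `B ⊆ 𝕋ⁿ_{r-1}` connected to
1 that decomposes `ℝ[x]_r`. -/
def IsBorderIdeal {n : ℕ} (G : Set (MvPolynomial (Fin n) ℝ)) (r : ℕ)
    (J : Ideal (MvPolynomial (Fin n) ℝ)) : Prop :=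
  (∃ B : Set (Fin n →₀ ℕ), DegreeLE B (r - 1) ∧ DivisionClosed B ∧ Decomposes G r B) ∧
  ∀ B : Set (Fin n →₀ ℕ), DegreeLE B (r - 1) → ConnectedToOne B → Decomposes G r B →
    J = Ideal.span (borderFamily G r B)

/-! ### Ideals -/

/-- The real radical of `I`: all `p` such that `p^(2k) + ∑ q_j² ∈ I` for some `k ≥ 1` and
polynomials `q_j`. -/
def realRadical {n : ℕ} (I : Ideal (MvPolynomial (Fin n) ℝ)) : Set (MvPolynomial (Fin n) ℝ) :=
  {p | ∃ k : ℕ, k ≠ 0 ∧ ∃ q, IsSumSq q ∧ p ^ (2 * k) + q ∈ I}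

/-- `I = (h₁, …, h_m)`. -/
def idealOf {n m : ℕ} (h : Fin m → MvPolynomial (Fin n) ℝ) : Ideal (MvPolynomial (Fin n) ℝ) :=
  Ideal.span (Set.range h)

/-- `D = max_j deg h_j`. -/
def maxDegree {n m : ℕ} (h : Fin m → MvPolynomial (Fin n) ℝ) : ℕ :=
  Finset.univ.sup fun j => (h j).totalDegree

/-! ### The two conditions at order `(t, s)` -/

theorem two_mul_le {s t : ℕ} (hst : s ≤ t / 2) : 2 * s ≤ t := by omega

theorem two_mul_pred_le {s t : ℕ} (hst : s ≤ t / 2) : 2 * (s - 1) ≤ t := by omega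

theorem pred_le {s t : ℕ} (hst : s ≤ t / 2) : s - 1 ≤ t := by omega

theorem two_mul_le_succ {s t : ℕ} (hst : s ≤ t / 2) : 2 * s ≤ t + 1 := by omega

/-- The rank condition `rank M_s(L) = rank M_{s-1}(L)`. -/
def RankCondition {n s t : ℕ} (hst : s ≤ t / 2) (L : Module.Dual ℝ (Poly n t)) : Prop :=
  (momentMatrix (two_mul_le hst) L).rank = (momentMatrix (two_mul_pred_le hst) L).rank

/-- `dim π_{2s}(G^⊥) = dim π_{s-1}(G^⊥)`, with `G^⊥ ⊆ (ℝ[x]_t)^*`. -/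
def ProjectionCondition {n s t : ℕ} (hst : s ≤ t / 2) (G : Set (MvPolynomial (Fin n) ℝ)) : Prop :=
  dimProj (two_mul_le hst) G = dimProj (pred_le hst) G

/-- `dim π_{2s}(G^⊥) = dim π_{2s}((G⁺)^⊥)`, with `G^⊥ ⊆ (ℝ[x]_t)^*` and
`(G⁺)^⊥ ⊆ (ℝ[x]_{t+1})^*`. -/
def ProlongationCondition {n s t : ℕ} (hst : s ≤ t / 2) (G : Set (MvPolynomial (Fin n) ℝ)) :
    Prop :=
  dimProj (two_mul_le hst) G = dimProj (two_mul_le_succ hst) (prolong G)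

end MomentProlongation

end

/-!
Write `S = Span(G_t)`, `d = ⌊t/2⌋`, `N = Ker M_d(L)` and `K = Ker M_s(L)`.

*Dimension counts.* `dim π_r(G^⊥)` is the codimension of `ℝ[x]_r ∩ S` in `ℝ[x]_r`
(`dimProj_add_finrank`). Hence the projection condition says `ℝ[x]_{2s} ⊆ ℝ[x]_{s-1} + S`, the
prolongation condition says `ℝ[x]_{2s} ∩ Span(G⁺) ⊆ S`, and, by positivity of `M_d(L)`, the rank
condition says that `M_s(L)` is flat: `ℝ[x]_s = ℝ[x]_{s-1} + K`.

*Flatness.* If `M_s(L)` is flat, the multiplications by the variables induce commuting operators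
on a complement of `K` in `ℝ[x]_s`, so the ideal `J = (K)` does not grow in degree `s`
(`mem_of_mem_span_of_mem_poly`). Reducing one factor of a monomial at a time shows that
`J ∩ ℝ[x]_{2s}` is spanned by products `x^α g` with `|α| ≤ s` and `g ∈ K`, which lie in `S` and on
which `L` vanishes (`mem_truncatedProducts_of_mem_span`). So `J` is real radical
(`span_momentKer_eq_realRadical`): a sum of squares in `J` reduces to one of polynomials of degree
at most `s - 1`, and positivity puts each of them in `K`.

*The generic kernel.* No atomic representation of `L` and no real Nullstellensatz is needed to
compare `J` with the real radical of `I`. The quotient of `ℝ[x]` by the real radical `Q` of `I`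
has no nontrivial vanishing sums of squares, so by compactness and separation
(`exists_linearMap_pos_of_sum_sq`) some form on `ℝ[x]_t` that vanishes on `Q` is positive on the
squares of all polynomials of degree at most `d` outside `Q`. This form belongs to the cone, and
genericity gives `K ⊆ N ⊆ Q` (`IsGeneric.momentKer_le_realRadical`). Thus always
`J ⊆ Q ⊆ I(V_ℝ(I))`, and `J = Q` when `s ≥ D`, since then `I ⊆ J`. In that case `G_t` and hence
`G_t⁺` lie in `J`, which gives the prolongation condition.

*The converse.* The prolongation condition puts all multiples of degree at most `2s` of an element
`p` of `ℝ[x]_s ∩ S` into `S`, where `L` vanishes; so `L(p²) = 0` and `ℝ[x]_s ∩ S = K`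
(`IsGeneric.inf_span_system_eq_momentKer`), and the projection condition turns into flatness. For
`r = s` and `r = 2s` the space `ℝ[x]_r ∩ S` is then the degree `r` part of `J`; standard monomials
of `J` give a division closed basis, and the border relations of any basis generate `J`
(`isBorderIdeal_of_inf_eq`).
-/

namespace MomentProlongation

/-! ### The real radical is a real ideal -/

theorem isSumSq_pow_even {R : Type*} [CommSemiring R] (a : R) (k : ℕ) : IsSumSq (a ^ (2 * k)) := by
  rw [two_mul, pow_add]
  exact IsSumSq.mul_self _

theorem isSumSq_map {R S : Type*} [CommSemiring R] [CommSemiring S] (f : R →+* S) {a : R}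
    (ha : IsSumSq a) : IsSumSq (f a) := by
  induction ha with
  | zero => simp
  | sq_add a hs ih => simpa using IsSumSq.sq_add (f a) ih

theorem isSumSq_pow {R : Type*} [CommSemiring R] {a : R} (ha : IsSumSq a) (k : ℕ) :
    IsSumSq (a ^ k) := by
  rw [← Subsemiring.mem_sumSq] at ha ⊢
  exact pow_mem ha k

/-- For `a` and `b` sums of squares, each term of the binomial expansion of `(a + b)^(k + l)`
has a factor `a^k` or `b^l`, so negativity of powers passes to sums. -/
theorem isSumSq_neg_add_pow {R : Type*} [CommRing R] {a b : R} {k l : ℕ} (ha : IsSumSq a)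
    (hb : IsSumSq b) (hak : IsSumSq (-a ^ k)) (hbl : IsSumSq (-b ^ l)) :
    IsSumSq (-(a + b) ^ (k + l)) := by
  rw [add_pow, ← Finset.sum_neg_distrib]
  apply IsSumSq.sum
  intro i hi
  rcases le_total k i with hki | hik
  · have : -(a ^ i * b ^ (k + l - i) * ((k + l).choose i : R)) =
        (-a ^ k) * (a ^ (i - k) * b ^ (k + l - i) * ((k + l).choose i : R)) := by
      rw [← pow_mul_pow_sub a hki]
      ring
    rw [this]
    exact hak.mul (((isSumSq_pow ha _).mul (isSumSq_pow hb _)).mul (IsSumSq.natCast _))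
  · have hli : l ≤ k + l - i := by omega
    have : -(a ^ i * b ^ (k + l - i) * ((k + l).choose i : R)) =
        (-b ^ l) * (a ^ i * b ^ (k + l - i - l) * ((k + l).choose i : R)) := by
      rw [← pow_mul_pow_sub b hli]
      ring
    rw [this]
    exact hbl.mul (((isSumSq_pow ha _).mul (isSumSq_pow hb _)).mul (IsSumSq.natCast _))

/-- A summand of a sum of squares inherits a negative power: `-a^k = -(a + b)^k + (…)`, where the
last term is a sum of squares. -/
theorem isSumSq_neg_pow_of_add {R : Type*} [CommRing R] {a b : R} {k : ℕ} (ha : IsSumSq a)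
    (hb : IsSumSq b) (hab : IsSumSq (-(a + b) ^ k)) : IsSumSq (-a ^ k) := by
  have hrest : IsSumSq ((a + b) ^ k - a ^ k) := by
    rw [add_pow, Finset.sum_range_succ]
    simp only [Nat.sub_self, pow_zero, mul_one, Nat.choose_self, Nat.cast_one, add_sub_cancel_right]
    exact IsSumSq.sum fun i _ =>
      ((isSumSq_pow ha _).mul (isSumSq_pow hb _)).mul (IsSumSq.natCast _)
  have : -a ^ k = -(a + b) ^ k + ((a + b) ^ k - a ^ k) := by ring
  rw [this]
  exact hab.add hrest

theorem exists_isSumSq_mk_eq {R : Type*} [CommRing R] (I : Ideal R) {x : R ⧸ I} (hx : IsSumSq x) :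
    ∃ q : R, IsSumSq q ∧ Ideal.Quotient.mk I q = x := by
  induction hx with
  | zero => exact ⟨0, IsSumSq.zero, map_zero _⟩
  | sq_add a hs ih =>
    obtain ⟨q, hq, rfl⟩ := ih
    obtain ⟨p, rfl⟩ := Ideal.Quotient.mk_surjective a
    exact ⟨p * p + q, IsSumSq.sq_add p hq, by simp⟩

theorem mem_realRadical_iff {n : ℕ} (I : Ideal (MvPolynomial (Fin n) ℝ))
    (p : MvPolynomial (Fin n) ℝ) :
    p ∈ realRadical I ↔
      ∃ k : ℕ, k ≠ 0 ∧ IsSumSq (-(Ideal.Quotient.mk I p ^ 2) ^ k) := by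
  constructor
  · rintro ⟨k, hk, q, hq, hmem⟩
    refine ⟨k, hk, ?_⟩
    rw [← Ideal.Quotient.eq_zero_iff_mem, map_add, map_pow, pow_mul] at hmem
    rw [neg_eq_of_add_eq_zero_right hmem]
    exact isSumSq_map _ hq
  · rintro ⟨k, hk, hs⟩
    obtain ⟨q, hq, hqe⟩ := exists_isSumSq_mk_eq I hs
    refine ⟨k, hk, q, hq, ?_⟩
    rw [← Ideal.Quotient.eq_zero_iff_mem, map_add, map_pow, pow_mul, hqe]
    ring

/-- The real radical, as an ideal. Sums are covered by
`(p + q)^2 + (p - q)^2 = 2 p^2 + 2 q^2` and the statements on sums of squares above. -/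
def realRadicalIdeal {n : ℕ} (I : Ideal (MvPolynomial (Fin n) ℝ)) :
    Ideal (MvPolynomial (Fin n) ℝ) where
  carrier := realRadical I
  zero_mem' := ⟨1, one_ne_zero, 0, IsSumSq.zero, by simp⟩
  add_mem' := by
    intro p q hp hq
    rw [mem_realRadical_iff] at hp hq ⊢
    obtain ⟨k, hk, hpk⟩ := hp
    obtain ⟨l, hl, hql⟩ := hq
    refine ⟨(k + l) + (k + l), by omega, ?_⟩
    rw [map_add]
    set a := Ideal.Quotient.mk I p
    set b := Ideal.Quotient.mk I q
    have h1 : IsSumSq (a ^ 2) := by simpa using isSumSq_pow_even a 1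
    have h2 : IsSumSq (b ^ 2) := by simpa using isSumSq_pow_even b 1
    have h3 : IsSumSq ((a + b) ^ 2) := by simpa using isSumSq_pow_even (a + b) 1
    have h4 : IsSumSq ((a - b) ^ 2) := by simpa using isSumSq_pow_even (a - b) 1
    have h5 := isSumSq_neg_add_pow h1 h2 hpk hql
    have h6 := isSumSq_neg_add_pow (h1.add h2) (h1.add h2) h5 h5
    apply isSumSq_neg_pow_of_add h3 h4
    rwa [show (a + b) ^ 2 + (a - b) ^ 2 = (a ^ 2 + b ^ 2) + (a ^ 2 + b ^ 2) by ring]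
  smul_mem' := by
    rintro c p ⟨k, hk, q, hq, hmem⟩
    refine ⟨k, hk, c ^ (2 * k) * q, (isSumSq_pow_even c k).mul hq, ?_⟩
    rw [smul_eq_mul, mul_pow, ← mul_add]
    exact I.mul_mem_left _ hmem

theorem subset_realRadical {n : ℕ} (I : Ideal (MvPolynomial (Fin n) ℝ)) :
    (I : Set (MvPolynomial (Fin n) ℝ)) ⊆ realRadical I := fun p hp =>
  ⟨1, one_ne_zero, 0, IsSumSq.zero, by
    rw [add_zero]
    exact I.pow_mem_of_mem hp _ (by norm_num)⟩

theorem realRadical_mono {n : ℕ} {I J : Ideal (MvPolynomial (Fin n) ℝ)} (hIJ : I ≤ J) :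
    realRadical I ⊆ realRadical J := fun _ ⟨k, hk, q, hq, hmem⟩ => ⟨k, hk, q, hq, hIJ hmem⟩

theorem mem_realRadical_of_sq_add_mem {n : ℕ} {I : Ideal (MvPolynomial (Fin n) ℝ)}
    {p q : MvPolynomial (Fin n) ℝ} (hq : IsSumSq q) (h : p ^ 2 + q ∈ realRadical I) :
    p ∈ realRadical I := by
  rw [mem_realRadical_iff] at h ⊢
  obtain ⟨k, hk, hs⟩ := h
  refine ⟨2 * k, by omega, ?_⟩
  rw [← pow_mul, map_add, map_pow] at hs
  exact isSumSq_neg_pow_of_add (by simpa using isSumSq_pow_even (Ideal.Quotient.mk I p) 1)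
    (isSumSq_map _ hq) hs

/-- An ideal in which `p^2 + ∑ q_j^2` can only lie if `p` does is real radical. -/
theorem eq_realRadical_of_sq_add {n : ℕ} {J : Ideal (MvPolynomial (Fin n) ℝ)}
    (hJ : ∀ p q : MvPolynomial (Fin n) ℝ, IsSumSq q → p ^ 2 + q ∈ J → p ∈ J) :
    (J : Set (MvPolynomial (Fin n) ℝ)) = realRadical J := by
  refine Set.Subset.antisymm (subset_realRadical J) ?_
  rintro p ⟨k, hk, q, hq, hmem⟩
  have hrad : J.IsRadical := by
    rw [Ideal.isRadical_iff_pow_one_lt 2 one_lt_two]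
    intro r hr
    exact hJ r 0 IsSumSq.zero (by simpa using hr)
  refine hrad ⟨k, hJ _ q hq ?_⟩
  rwa [← pow_mul, mul_comm k 2]

theorem realRadical_le_vanishingIdeal {n : ℕ} (I : Ideal (MvPolynomial (Fin n) ℝ)) :
    realRadicalIdeal I ≤ vanishingIdeal ℝ (zeroLocus ℝ I) := by
  rintro p ⟨k, hk, q, hq, hmem⟩
  rw [mem_vanishingIdeal_iff]
  intro v hv
  have h0 := hv _ hmem
  rw [map_add, map_pow] at h0
  have h1 : 0 ≤ aeval v q := (isSumSq_map (aeval v : MvPolynomial (Fin n) ℝ →ₐ[ℝ] ℝ).toRingHom hq).nonneg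
  have h2 : 0 ≤ (aeval v p) ^ (2 * k) := by
    rw [pow_mul]
    positivity
  exact eq_zero_of_pow_eq_zero (n := 2 * k) (by linarith)

/-! ### Separation of the cone of squares from the origin -/

open scoped MatrixOrder in
theorem exists_eq_conjTranspose_mul_self {k : ℕ} {G : Matrix (Fin k) (Fin k) ℝ}
    (hG : G.PosSemidef) : ∃ B : Matrix (Fin k) (Fin k) ℝ, G = B.conjTranspose * B :=
  CStarAlgebra.nonneg_iff_eq_star_mul_self.mp hG.nonneg

/-- If no nontrivial sum of squares of elements of a finite dimensional subspace `W` vanishes,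
then some linear form is positive on all nonzero squares. The images of the positive semidefinite
Gram matrices of trace one form a compact convex set that avoids `0`; a linear form that
separates them from `0` does it. -/
theorem exists_linearMap_pos_of_sum_sq {A : Type*} [CommRing A] [Algebra ℝ A] (W : Submodule ℝ A)
    [FiniteDimensional ℝ W]
    (hW : ∀ (k : ℕ) (w : Fin k → A), (∀ i, w i ∈ W) → ∑ i, w i ^ 2 = 0 → ∀ i, w i = 0) :
    ∃ f : A →ₗ[ℝ] ℝ, ∀ w ∈ W, w ≠ 0 → 0 < f (w ^ 2) := by
  classical
  set k := Module.finrank ℝ W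
  let b : Module.Basis (Fin k) ℝ W := Module.finBasis ℝ W
  have hfin : (W * W).FG :=
    Submodule.FG.mul (Module.Finite.iff_fg.mp inferInstance) (Module.Finite.iff_fg.mp inferInstance)
  let F : Submodule ℝ A := W * W
  have : FiniteDimensional ℝ F := Module.Finite.iff_fg.mpr hfin
  let φ : F ≃ₗ[ℝ] (Fin (Module.finrank ℝ F) → ℝ) := (Module.finBasis ℝ F).equivFun
  let e : Fin k → Fin k → F := fun i j => ⟨b i * b j, Submodule.mul_mem_mul (b i).2 (b j).2⟩
  let Φ : Matrix (Fin k) (Fin k) ℝ →ₗ[ℝ] F :=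
    { toFun := fun G => ∑ i, ∑ j, G i j • e i j
      map_add' := by
        intro G G'
        simp only [Matrix.add_apply, add_smul, Finset.sum_add_distrib]
      map_smul' := by
        intro c G
        simp only [Matrix.smul_apply, smul_eq_mul, mul_smul, Finset.smul_sum, RingHom.id_apply] }
  let v : (Fin k → ℝ) → A := fun c => ∑ i, c i • (b i : A)
  have hvW : ∀ c, v c ∈ W := fun c => W.sum_mem fun i _ => W.smul_mem _ (b i).2
  have hv0 : ∀ c, v c = 0 → c = 0 := by
    intro c hc
    have h1 : ∑ i, c i • b i = 0 := by
      apply Subtype.ext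
      simpa [v] using hc
    funext i
    exact Fintype.linearIndependent_iff.mp b.linearIndependent c h1 i
  -- the Gram matrix `Bᵀ B` represents the sum of the squares given by the rows of `B`
  have hΦ : ∀ B : Matrix (Fin k) (Fin k) ℝ,
      (Φ (B.transpose * B) : A) = ∑ l, v (B l) ^ 2 := by
    intro B
    simp only [Φ, v, e, LinearMap.coe_mk, AddHom.coe_mk, Matrix.mul_apply, Matrix.transpose_apply,
      AddSubmonoidClass.coe_finsetSum, SetLike.val_smul, sq, Finset.sum_mul_sum, Finset.sum_smul]
    rw [Finset.sum_comm' (t' := Finset.univ) (s' := fun _ => Finset.univ) (by simp)]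
    rw [Finset.sum_comm]
    simp_rw [smul_mul_smul_comm]
    conv_rhs => rw [Finset.sum_comm]
    conv_rhs => enter [2, i]; rw [Finset.sum_comm]
  let S : Set (Matrix (Fin k) (Fin k) ℝ) := {B | ∑ l, ∑ i, B l i ^ 2 = 1}
  have hS : IsCompact S := by
    have hK : IsCompact (Set.univ.pi fun _ => Set.univ.pi fun _ => Set.Icc (-1) 1 :
        Set (Fin k → Fin k → ℝ)) :=
      isCompact_univ_pi fun _ => isCompact_univ_pi fun _ => isCompact_Icc
    refine hK.of_isClosed_subset (isClosed_eq (by fun_prop) continuous_const) ?_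
    intro B hB l _ i _
    have h1 : B l i ^ 2 ≤ 1 := by
      rw [← (show ∑ l, ∑ i, B l i ^ 2 = 1 from hB)]
      refine le_trans ?_ (Finset.single_le_sum (f := fun l => ∑ i, B l i ^ 2)
        (fun l _ => Finset.sum_nonneg fun i _ => sq_nonneg _) (Finset.mem_univ l))
      exact Finset.single_le_sum (f := fun i => B l i ^ 2)
        (fun i _ => sq_nonneg _) (Finset.mem_univ i)
    exact abs_le.mp ((sq_le_one_iff_abs_le_one _).mp h1)
  let C : Set (Matrix (Fin k) (Fin k) ℝ) := (fun B => B.transpose * B) '' S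
  have hC : IsCompact C := hS.image (by fun_prop)
  have htr : ∀ B : Matrix (Fin k) (Fin k) ℝ, (B.transpose * B).trace = ∑ l, ∑ i, B l i ^ 2 := by
    intro B
    simp only [Matrix.trace, Matrix.diag, Matrix.mul_apply, Matrix.transpose_apply, sq]
    exact Finset.sum_comm
  have hCe : C = {G | G.PosSemidef ∧ G.trace = 1} := by
    ext G
    constructor
    · rintro ⟨B, hB, rfl⟩
      refine ⟨?_, (htr B).trans hB⟩
      simpa using Matrix.posSemidef_conjTranspose_mul_self B
    · rintro ⟨hG, ht⟩
      obtain ⟨B, rfl⟩ := exists_eq_conjTranspose_mul_self hG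
      rw [Matrix.conjTranspose_eq_transpose_of_trivial] at ht ⊢
      exact ⟨B, (htr B).symm.trans ht, rfl⟩
  have hCc : Convex ℝ C := by
    rw [hCe]
    rintro G ⟨hG, hGt⟩ G' ⟨hG', hGt'⟩ a c ha hc hac
    refine ⟨(hG.smul ha).add (hG'.smul hc), ?_⟩
    rw [Matrix.trace_add, Matrix.trace_smul, Matrix.trace_smul, hGt, hGt']
    simpa using hac
  let Ψ : Matrix (Fin k) (Fin k) ℝ →ₗ[ℝ] (Fin (Module.finrank ℝ F) → ℝ) := φ.toLinearMap ∘ₗ Φ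
  have hΨ : Continuous Ψ := Ψ.continuous_of_finiteDimensional
  have h0 : (0 : Fin (Module.finrank ℝ F) → ℝ) ∉ Ψ '' C := by
    rintro ⟨_, ⟨B, hB, rfl⟩, h⟩
    have h1 : Φ (B.transpose * B) = 0 := φ.map_eq_zero_iff.mp h
    have h2 : ∑ l, v (B l) ^ 2 = 0 := by rw [← hΦ, h1]; rfl
    have h3 := hW k (fun l => v (B l)) (fun l => hvW _) h2
    have h4 : B = 0 := funext fun l => hv0 _ (h3 l)
    have h5 : ∑ l, ∑ i, B l i ^ 2 = 1 := hB
    rw [h4] at h5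
    simp at h5
  obtain ⟨f, u, hfu, hf⟩ := geometric_hahn_banach_point_closed (hCc.linear_image Ψ)
    (hC.image hΨ).isClosed h0
  rw [map_zero] at hfu
  obtain ⟨g, hg⟩ := (f.toLinearMap ∘ₗ φ.toLinearMap).exists_extend
  refine ⟨g, fun w hw hw0 => ?_⟩
  let c : Fin k → ℝ := fun i => b.repr ⟨w, hw⟩ i
  have hvc : v c = w := by
    have h1 := congrArg (W.subtype) (b.sum_repr ⟨w, hw⟩)
    rw [map_sum] at h1
    exact h1
  -- for `w ≠ 0` the coordinate vector has positive length `r`, and `w^2 / r^2` lies in the image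
  set r2 : ℝ := ∑ i, c i ^ 2
  have hr2 : 0 < r2 := by
    refine lt_of_le_of_ne (Finset.sum_nonneg fun i _ => sq_nonneg _) (Ne.symm ?_)
    intro h
    apply hw0
    rw [← hvc]
    have : ∀ i, c i = 0 := fun i => by
      have := (Finset.sum_eq_zero_iff_of_nonneg (fun i _ => sq_nonneg (c i))).mp h i
        (Finset.mem_univ i)
      exact pow_eq_zero_iff (two_ne_zero) |>.mp this
    simp [v, this]
  have hmem : r2⁻¹ • Matrix.vecMulVec c c ∈ C := by
    rw [hCe]
    refine ⟨Matrix.PosSemidef.smul ?_ (inv_nonneg.mpr hr2.le), ?_⟩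
    · simpa using Matrix.posSemidef_vecMulVec_self_star c
    · rw [Matrix.trace_smul, Matrix.trace_vecMulVec, smul_eq_mul]
      have : c ⬝ᵥ c = r2 := by simp [dotProduct, r2, sq]
      rw [this]
      exact inv_mul_cancel₀ hr2.ne'
  have hpos := hfu.trans (hf _ ⟨_, hmem, rfl⟩)
  have hval : (Φ (Matrix.vecMulVec c c) : A) = w ^ 2 := by
    rw [← hvc]
    simp only [Φ, v, e, LinearMap.coe_mk, AddHom.coe_mk, Matrix.vecMulVec_apply,
      AddSubmonoidClass.coe_finsetSum, SetLike.val_smul, sq, Finset.sum_mul_sum,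
      smul_mul_smul_comm]
  have hgF : ∀ x : F, g x = f (φ x) := fun x => LinearMap.congr_fun hg x
  rw [← hval, hgF]
  rw [map_smul, map_smul, smul_eq_mul] at hpos
  exact pos_of_mul_pos_right hpos (inv_nonneg.mpr hr2.le)

/-! ### Truncated polynomial spaces -/

theorem poly_eq_span (n r : ℕ) :
    Poly n r = Submodule.span ℝ ((fun α => monomial α (1 : ℝ)) '' {α | α.degree ≤ r}) :=
  restrictSupport_eq_span ..

theorem poly_le_iff {n r : ℕ} {W : Submodule ℝ (MvPolynomial (Fin n) ℝ)} :
    Poly n r ≤ W ↔ ∀ α : Fin n →₀ ℕ, α.degree ≤ r → monomial α 1 ∈ W := by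
  rw [poly_eq_span, Submodule.span_le, Set.image_subset_iff]
  rfl

theorem degree_le_of_mem_support {n r : ℕ} {p : MvPolynomial (Fin n) ℝ} (hp : p ∈ Poly n r)
    {α : Fin n →₀ ℕ} (hα : α ∈ p.support) : α.degree ≤ r :=
  (le_totalDegree hα).trans ((mem_restrictTotalDegree _ _ _).mp hp)

theorem mul_mem_poly {n r r' k : ℕ} {p q : MvPolynomial (Fin n) ℝ} (hp : p ∈ Poly n r)
    (hq : q ∈ Poly n r') (hk : r + r' ≤ k) : p * q ∈ Poly n k := by
  rw [mem_restrictTotalDegree] at *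
  exact (totalDegree_mul p q).trans (by omega)

theorem X_mem_poly {n : ℕ} (i : Fin n) : (X i : MvPolynomial (Fin n) ℝ) ∈ Poly n 1 :=
  (mem_restrictTotalDegree _ _ _).mpr (totalDegree_X i).le

theorem one_mem_poly (n r : ℕ) : (1 : MvPolynomial (Fin n) ℝ) ∈ Poly n r :=
  (mem_restrictTotalDegree _ _ _).mpr (by simp)

/-- A nonconstant monomial is a variable times a monomial of smaller degree. -/
theorem exists_eq_add_single {n : ℕ} {α : Fin n →₀ ℕ} (hα : α ≠ 0) :
    ∃ (β : Fin n →₀ ℕ) (i : Fin n), α = β + Finsupp.single i 1 ∧ α.degree = β.degree + 1 := by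
  obtain ⟨i, hi⟩ := Finsupp.ne_iff.mp hα
  have h1 : Finsupp.single i 1 ≤ α := by
    rw [Finsupp.single_le_iff]
    exact Nat.one_le_iff_ne_zero.mpr hi
  have h2 : α = (α - Finsupp.single i 1) + Finsupp.single i 1 := (tsub_add_cancel_of_le h1).symm
  refine ⟨α - Finsupp.single i 1, i, h2, ?_⟩
  conv_lhs => rw [h2]
  rw [map_add, Finsupp.degree_single]

theorem monomial_add_single_eq {n : ℕ} (β : Fin n →₀ ℕ) (i : Fin n) :
    monomial (β + Finsupp.single i 1) (1 : ℝ) = X i * monomial β 1 := by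
  rw [X, monomial_mul, one_mul, add_comm]

/-- A monomial of degree at most `r + r'` is a product of monomials of degree at most `r` and
at most `r'`. -/
theorem exists_eq_add_degree_le {n r r' : ℕ} {α : Fin n →₀ ℕ} (hα : α.degree ≤ r + r') :
    ∃ β γ : Fin n →₀ ℕ, α = β + γ ∧ β.degree ≤ r ∧ γ.degree ≤ r' := by
  induction r generalizing α with
  | zero => exact ⟨0, α, by simp, by simp, by omega⟩
  | succ r ih =>
    by_cases h0 : α = 0
    · exact ⟨0, 0, by simp [h0], by simp, by simp⟩
    · obtain ⟨δ, i, rfl, hd⟩ := exists_eq_add_single h0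
      obtain ⟨β, γ, rfl, hβ, hγ⟩ := ih (α := δ) (by omega)
      refine ⟨β + Finsupp.single i 1, γ, by abel, ?_, hγ⟩
      rw [map_add, Finsupp.degree_single]
      omega

/-! ### Moment matrices in terms of linear forms on all polynomials -/

theorem exists_extend_form {n t : ℕ} (L : Module.Dual ℝ (Poly n t)) :
    ∃ ℓ : MvPolynomial (Fin n) ℝ →ₗ[ℝ] ℝ, ∀ p : Poly n t, ℓ p = L p := by
  obtain ⟨ℓ, hℓ⟩ := LinearMap.exists_extend L
  exact ⟨ℓ, fun p => LinearMap.congr_fun hℓ p⟩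

theorem sum_vec_smul {n s : ℕ} {p : MvPolynomial (Fin n) ℝ} (hp : p ∈ Poly n s) :
    ∑ β : Expo n s, vec n s p β • monomial β.1 (1 : ℝ) = p := by
  classical
  ext α
  simp only [coeff_sum, coeff_smul, coeff_monomial, smul_eq_mul, mul_ite, mul_one, mul_zero, vec,
    LinearMap.pi_apply, lcoeff_apply]
  by_cases hα : α.degree ≤ s
  · rw [Finset.sum_eq_single ⟨α, hα⟩]
    · simp
    · intro β _ hβ
      rw [if_neg fun h => hβ (Subtype.ext h)]
    · simp
  · rw [Finset.sum_eq_zero, eq_comm]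
    · by_contra h
      exact hα (degree_le_of_mem_support hp (mem_support_iff.mpr h))
    · rintro ⟨β, hβ⟩ _
      rw [if_neg]
      rintro rfl
      exact hα hβ

theorem sum_smul_mem_poly {n s : ℕ} (x : Expo n s → ℝ) :
    ∑ β : Expo n s, x β • monomial β.1 (1 : ℝ) ∈ Poly n s :=
  Submodule.sum_mem _ fun β _ => Submodule.smul_mem _ _ (monomial_mem_poly β.2)

theorem vec_sum_smul {n s : ℕ} (x : Expo n s → ℝ) :
    vec n s (∑ β : Expo n s, x β • monomial β.1 (1 : ℝ)) = x := by
  classical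
  funext α
  simp only [vec, LinearMap.pi_apply, lcoeff_apply, coeff_sum, coeff_smul, coeff_monomial,
    smul_eq_mul, mul_ite, mul_one, mul_zero]
  rw [Finset.sum_eq_single α]
  · simp
  · intro β _ hβ
    rw [if_neg fun h => hβ (Subtype.ext h)]
  · simp

section

variable {n s t : ℕ} {hst : 2 * s ≤ t} {L : Module.Dual ℝ (Poly n t)}
  {ℓ : MvPolynomial (Fin n) ℝ →ₗ[ℝ] ℝ}

theorem momentMatrix_mulVec_apply (hℓ : ∀ p : Poly n t, ℓ p = L p) {p : MvPolynomial (Fin n) ℝ}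
    (hp : p ∈ Poly n s) (α : Expo n s) :
    (momentMatrix hst L).mulVec (vec n s p) α = ℓ (monomial α.1 1 * p) := by
  conv_rhs => rw [← sum_vec_smul hp]
  simp only [Finset.mul_sum, map_sum, mul_smul_comm, map_smul, monomial_mul, one_mul, smul_eq_mul,
    Matrix.mulVec, dotProduct, momentMatrix, Matrix.of_apply]
  refine Finset.sum_congr rfl fun β _ => ?_
  rw [← hℓ ⟨_, add_mem_poly hst α β⟩, mul_comm]

theorem dotProduct_momentMatrix_mulVec (hℓ : ∀ p : Poly n t, ℓ p = L p)
    {p q : MvPolynomial (Fin n) ℝ} (hp : p ∈ Poly n s) (hq : q ∈ Poly n s) :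
    vec n s q ⬝ᵥ (momentMatrix hst L).mulVec (vec n s p) = ℓ (q * p) := by
  conv_rhs => rw [← sum_vec_smul hq]
  simp only [Finset.sum_mul, map_sum, smul_mul_assoc, map_smul, smul_eq_mul, dotProduct,
    momentMatrix_mulVec_apply hℓ hp]

theorem mem_momentKer_iff (hℓ : ∀ p : Poly n t, ℓ p = L p) {p : MvPolynomial (Fin n) ℝ} :
    p ∈ momentKer hst L ↔ p ∈ Poly n s ∧ ∀ q ∈ Poly n s, ℓ (q * p) = 0 := by
  rw [momentKer, Submodule.mem_inf]
  refine and_congr_right fun hp => ?_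
  rw [LinearMap.mem_ker, LinearMap.comp_apply, Matrix.mulVecLin_apply]
  constructor
  · intro h q hq
    rw [← dotProduct_momentMatrix_mulVec (hst := hst) hℓ hp hq, h, dotProduct_zero]
  · intro h
    funext α
    rw [momentMatrix_mulVec_apply hℓ hp, h _ (monomial_mem_poly α.2), Pi.zero_apply]

theorem momentMatrix_isHermitian : (momentMatrix hst L).IsHermitian := by
  ext α β
  simp only [momentMatrix, Matrix.conjTranspose_apply, Matrix.of_apply, star_trivial]
  congr 3
  rw [add_comm]

theorem momentMatrix_posSemidef_iff (hℓ : ∀ p : Poly n t, ℓ p = L p) :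
    (momentMatrix hst L).PosSemidef ↔ ∀ p ∈ Poly n s, 0 ≤ ℓ (p * p) := by
  constructor
  · intro h p hp
    rw [← dotProduct_momentMatrix_mulVec (hst := hst) hℓ hp hp]
    simpa using h.dotProduct_mulVec_nonneg (vec n s p)
  · intro h
    refine Matrix.PosSemidef.of_dotProduct_mulVec_nonneg momentMatrix_isHermitian fun x => ?_
    rw [← vec_sum_smul x, star_trivial,
      dotProduct_momentMatrix_mulVec hℓ (sum_smul_mem_poly x) (sum_smul_mem_poly x)]
    exact h _ (sum_smul_mem_poly x)

theorem rank_momentMatrix_add_finrank_momentKer :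
    (momentMatrix hst L).rank + Module.finrank ℝ (momentKer hst L) =
      Module.finrank ℝ (Poly n s) := by
  set c : Poly n s →ₗ[ℝ] (Expo n s → ℝ) :=
    ((momentMatrix hst L).mulVecLin ∘ₗ vec n s).domRestrict (Poly n s) with hc
  have hrange : LinearMap.range c = LinearMap.range (momentMatrix hst L).mulVecLin := by
    apply le_antisymm
    · rintro _ ⟨p, rfl⟩
      exact ⟨vec n s p, rfl⟩
    · rintro _ ⟨x, rfl⟩
      refine ⟨⟨_, sum_smul_mem_poly x⟩, ?_⟩
      rw [hc, LinearMap.domRestrict_apply, LinearMap.comp_apply, vec_sum_smul]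
  have hker : momentKer hst L = (LinearMap.ker c).map (Poly n s).subtype := by
    rw [hc, LinearMap.ker_domRestrict, momentKer, Submodule.map_comap_subtype]
  rw [hker, Submodule.finrank_map_subtype_eq, Matrix.rank, ← hrange]
  exact LinearMap.finrank_range_add_finrank_ker c

end

/-! ### Dimensions of projected orthogonal spaces -/

theorem map_proj_perp {n r t : ℕ} (hrt : r ≤ t) {G : Set (MvPolynomial (Fin n) ℝ)}
    (hG : G ⊆ Poly n t) :
    (perp t G).map (proj hrt) =
      ((Submodule.span ℝ G).comap (Poly n r).subtype).dualAnnihilator := by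
  apply le_antisymm
  · rintro _ ⟨L, hL, rfl⟩
    rw [Submodule.mem_dualAnnihilator]
    intro p hp
    obtain ⟨ℓ, hℓ⟩ := exists_extend_form L
    have h1 : Submodule.span ℝ G ≤ LinearMap.ker ℓ := by
      rw [Submodule.span_le]
      intro g hg
      exact (hℓ ⟨g, hG hg⟩).trans (hL _ hg)
    exact (hℓ ⟨p, poly_mono hrt p.2⟩).symm.trans (h1 hp)
  · intro f hf
    -- `f` factors through `ℝ[x]_r / (ℝ[x]_r ∩ Span G)`, which embeds into `ℝ[x] / Span G`
    have hker : (Submodule.span ℝ G).comap (Poly n r).subtype =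
        LinearMap.ker ((Submodule.span ℝ G).mkQ ∘ₗ (Poly n r).subtype) := by
      rw [LinearMap.ker_comp, Submodule.ker_mkQ]
    rw [hker, ← LinearMap.range_dualMap_eq_dualAnnihilator_ker] at hf
    obtain ⟨g, rfl⟩ := hf
    refine ⟨g ∘ₗ (Submodule.span ℝ G).mkQ ∘ₗ (Poly n t).subtype, fun p hp => ?_, rfl⟩
    have h0 : (Submodule.span ℝ G).mkQ (p : MvPolynomial (Fin n) ℝ) = 0 :=
      (Submodule.Quotient.mk_eq_zero _).mpr (Submodule.subset_span hp)
    rw [LinearMap.comp_apply, LinearMap.comp_apply, Submodule.subtype_apply, h0, map_zero]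

theorem dimProj_add_finrank {n r t : ℕ} (hrt : r ≤ t) {G : Set (MvPolynomial (Fin n) ℝ)}
    (hG : G ⊆ Poly n t) :
    dimProj hrt G + Module.finrank ℝ (Poly n r ⊓ Submodule.span ℝ G : Submodule ℝ _) =
      Module.finrank ℝ (Poly n r) := by
  rw [dimProj, map_proj_perp hrt hG, ← Submodule.map_comap_subtype,
    Submodule.finrank_map_subtype_eq, add_comm]
  exact Subspace.finrank_add_finrank_dualAnnihilator_eq _

/-- For `U ≤ V` and a subspace `W`, the equality `dim V - dim (V ⊓ W) = dim U - dim (U ⊓ W)`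
says that `W` and `U` together contain `V`. -/
theorem le_sup_iff_of_finrank {E : Type*} [AddCommGroup E] [Module ℝ E] {U V W : Submodule ℝ E}
    [FiniteDimensional ℝ V] (hUV : U ≤ V) {a b : ℕ}
    (ha : a + Module.finrank ℝ (V ⊓ W : Submodule ℝ E) = Module.finrank ℝ V)
    (hb : b + Module.finrank ℝ (U ⊓ W : Submodule ℝ E) = Module.finrank ℝ U) :
    a = b ↔ V ≤ U ⊔ (V ⊓ W) := by
  have : FiniteDimensional ℝ U := Submodule.finiteDimensional_of_le hUV
  have h1 := Submodule.finrank_sup_add_finrank_inf_eq U (V ⊓ W)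
  rw [← inf_assoc, inf_eq_left.mpr hUV] at h1
  have h2 : U ⊔ (V ⊓ W) ≤ V := sup_le hUV inf_le_left
  constructor
  · intro h
    exact (Submodule.eq_of_le_of_finrank_eq h2 (by omega)).ge
  · intro h
    rw [le_antisymm h2 h] at h1
    omega

/-! ### Kernels of positive semidefinite moment matrices -/

section

variable {n s t : ℕ} {L : Module.Dual ℝ (Poly n t)} {ℓ : MvPolynomial (Fin n) ℝ →ₗ[ℝ] ℝ}

theorem momentMatrix_posSemidef_of_le {d : ℕ} {hdt : 2 * d ≤ t} {hst : 2 * s ≤ t} (hsd : s ≤ d)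
    (hL : (momentMatrix hdt L).PosSemidef) : (momentMatrix hst L).PosSemidef := by
  obtain ⟨ℓ, hℓ⟩ := exists_extend_form L
  rw [momentMatrix_posSemidef_iff hℓ] at hL ⊢
  exact fun p hp => hL p (poly_mono hsd hp)

theorem mem_momentKer_iff_sq {hst : 2 * s ≤ t} (hℓ : ∀ p : Poly n t, ℓ p = L p)
    (hL : (momentMatrix hst L).PosSemidef) {p : MvPolynomial (Fin n) ℝ} :
    p ∈ momentKer hst L ↔ p ∈ Poly n s ∧ ℓ (p * p) = 0 := by
  constructor
  · intro hp
    rw [mem_momentKer_iff hℓ] at hp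
    exact ⟨hp.1, hp.2 p hp.1⟩
  · rintro ⟨hp, h0⟩
    refine ⟨hp, (hL.dotProduct_mulVec_zero_iff (vec n s p)).1 ?_⟩
    rw [star_trivial, dotProduct_momentMatrix_mulVec hℓ hp hp, h0]

/-- For a positive semidefinite moment matrix, the kernels of the smaller moment matrices are the
truncations of its kernel. -/
theorem momentKer_eq_inf {d : ℕ} {hdt : 2 * d ≤ t} {hst : 2 * s ≤ t} (hsd : s ≤ d)
    (hL : (momentMatrix hdt L).PosSemidef) :
    momentKer hst L = Poly n s ⊓ momentKer hdt L := by
  obtain ⟨ℓ, hℓ⟩ := exists_extend_form L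
  ext p
  rw [Submodule.mem_inf, mem_momentKer_iff_sq hℓ (momentMatrix_posSemidef_of_le hsd hL),
    mem_momentKer_iff_sq hℓ hL]
  exact ⟨fun h => ⟨h.1, poly_mono hsd h.1, h.2⟩, fun h => ⟨h.1, h.2.2⟩⟩

end

/-- The generic kernel lies in the real radical of `I`. The quotient by the real radical has no
nontrivial vanishing sums of squares, so some linear form on it is positive on all nonzero
squares; pulled back to `ℝ[x]_t` it is an element of the cone whose moment matrix has no other
kernel than the polynomials in the real radical, and the generic kernel is contained in it. -/
theorem IsGeneric.momentKer_le_realRadical {n m : ℕ} {h : Fin m → MvPolynomial (Fin n) ℝ} {t : ℕ}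
    {L : Module.Dual ℝ (Poly n t)} (hL : IsGeneric h t L) {p : MvPolynomial (Fin n) ℝ}
    (hp : p ∈ momentKer (Nat.mul_div_le t 2) L) : p ∈ realRadicalIdeal (idealOf h) := by
  set Q := realRadicalIdeal (idealOf h) with hQ
  let π : MvPolynomial (Fin n) ℝ →ₗ[ℝ] MvPolynomial (Fin n) ℝ ⧸ Q :=
    (Ideal.Quotient.mkₐ ℝ Q).toLinearMap
  have hπ : ∀ q, π q = 0 ↔ q ∈ Q := fun q => Ideal.Quotient.eq_zero_iff_mem
  have hπsq : ∀ q, π (q * q) = π q ^ 2 := fun q => by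
    rw [sq]
    exact map_mul (Ideal.Quotient.mk Q) q q
  have hW : ∀ (k : ℕ) (w : Fin k → MvPolynomial (Fin n) ℝ ⧸ Q),
      (∀ i, w i ∈ (Poly n (t / 2)).map π) → ∑ i, w i ^ 2 = 0 → ∀ i, w i = 0 := by
    intro k w hw h0 i
    choose q _ hq using hw
    rw [← hq, hπ]
    refine mem_realRadical_of_sq_add_mem (q := ∑ j ∈ Finset.univ.erase i, q j ^ 2)
      (IsSumSq.sum_sq _ _) ?_
    rw [Finset.add_sum_erase _ (fun j => q j ^ 2) (Finset.mem_univ i)]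
    change _ ∈ Q
    rw [← hπ, map_sum, ← h0]
    exact Finset.sum_congr rfl fun j _ => by rw [← hq, sq, hπsq]
  obtain ⟨f, hf⟩ := exists_linearMap_pos_of_sum_sq ((Poly n (t / 2)).map π) hW
  let ℓ : MvPolynomial (Fin n) ℝ →ₗ[ℝ] ℝ := f ∘ₗ π
  have hℓ : ∀ q : Poly n t, ℓ q = (ℓ ∘ₗ (Poly n t).subtype) q := fun _ => rfl
  have hcone : ℓ ∘ₗ (Poly n t).subtype ∈ posCone h t := by
    constructor
    · rintro q ⟨α, j, _, hq⟩
      have h1 : (q : MvPolynomial (Fin n) ℝ) ∈ Q := by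
        rw [hq]
        exact Q.mul_mem_left _ (subset_realRadical _ (Ideal.subset_span ⟨j, rfl⟩))
      change f (π q) = 0
      rw [(hπ _).mpr h1, map_zero]
    · rw [momentMatrix_posSemidef_iff hℓ]
      intro q hq
      change 0 ≤ f (π (q * q))
      rw [hπsq]
      by_cases h0 : π q = 0
      · simp [h0]
      · exact (hf _ ⟨q, hq, rfl⟩ h0).le
  have hp' := hL.momentKer_le hcone hp
  rw [mem_momentKer_iff hℓ] at hp'
  have h1 : f (π p ^ 2) = 0 := by
    rw [← hπsq]
    exact hp'.2 p hp'.1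
  by_contra hpQ
  exact (hf _ ⟨p, hp'.1, rfl⟩ fun h0 => hpQ ((hπ p).mp h0)).ne' h1

/-! ### Extending a truncated ideal -/

open scoped IsMulCommutative in
/-- Pairwise commuting endomorphisms make a vector space a module over the polynomial ring. -/
theorem exists_algHom_of_commute {n : ℕ} {V : Type*} [AddCommGroup V] [Module ℝ V]
    (T : Fin n → Module.End ℝ V) (hT : ∀ i j, T i * T j = T j * T i) :
    ∃ Ψ : MvPolynomial (Fin n) ℝ →ₐ[ℝ] Module.End ℝ V, ∀ i, Ψ (X i) = T i := by
  have hc : ∀ x ∈ Set.range T, ∀ y ∈ Set.range T, x * y = y * x := by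
    rintro _ ⟨i, rfl⟩ _ ⟨j, rfl⟩
    exact hT i j
  have := Algebra.isMulCommutative_adjoin ℝ hc
  let Ψ : MvPolynomial (Fin n) ℝ →ₐ[ℝ] Algebra.adjoin ℝ (Set.range T) :=
    aeval fun i => ⟨T i, Algebra.subset_adjoin ⟨i, rfl⟩⟩
  exact ⟨(Algebra.adjoin ℝ (Set.range T)).val.comp Ψ, fun i => by simp [Ψ]⟩

/-- A subspace `W` that contains `1` and is stable under the variables, both modulo an ideal `J`,
represents all polynomials modulo `J`. -/
theorem sup_ideal_eq_top {n : ℕ} {W : Submodule ℝ (MvPolynomial (Fin n) ℝ)}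
    {J : Ideal (MvPolynomial (Fin n) ℝ)} (h1 : 1 ∈ W ⊔ J.restrictScalars ℝ)
    (hX : ∀ w ∈ W, ∀ i, X i * w ∈ W ⊔ J.restrictScalars ℝ) :
    W ⊔ J.restrictScalars ℝ = ⊤ := by
  rw [eq_top_iff]
  rintro p -
  induction p using MvPolynomial.induction_on with
  | C a =>
    rw [← mul_one (C a), ← smul_eq_C_mul]
    exact Submodule.smul_mem _ _ h1
  | add p q hp hq => exact Submodule.add_mem _ hp hq
  | mul_X p i hp =>
    obtain ⟨w, hw, j, hj, rfl⟩ := Submodule.mem_sup.mp hp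
    rw [mul_comm, mul_add]
    exact Submodule.add_mem _ (hX w hw i)
      (Submodule.mem_sup_right (J.mul_mem_left _ hj))

/-- A subspace `K` of `ℝ[x]_s` that covers `ℝ[x]_s` modulo `ℝ[x]_{s-1}`, and that contains the
differences `x_i p - x_j q` of degree at most `s` for `p, q ∈ K`, is the degree `s` part of the
ideal it generates: the multiplications by the variables induce commuting operators on a
complement of `K` in `ℝ[x]_s`, and the representation of `ℝ[x]` that they define annihilates `K`
and extends the projection from `ℝ[x]_s` onto the complement. -/
theorem mem_of_mem_span_of_mem_poly {n s : ℕ} (hs : 1 ≤ s)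
    {K : Submodule ℝ (MvPolynomial (Fin n) ℝ)} (hK : K ≤ Poly n s)
    (hred : Poly n s ≤ Poly n (s - 1) ⊔ K)
    (hcomm : ∀ p ∈ K, ∀ q ∈ K, ∀ i j, X i * p - X j * q ∈ Poly n s → X i * p - X j * q ∈ K)
    {f : MvPolynomial (Fin n) ℝ} (hf : f ∈ Ideal.span (K : Set (MvPolynomial (Fin n) ℝ)))
    (hfs : f ∈ Poly n s) : f ∈ K := by
  set P := Poly n (s - 1)
  have hXP : ∀ p ∈ P, ∀ i, X i * p ∈ Poly n s := fun p hp i =>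
    mul_mem_poly (X_mem_poly i) hp (by omega)
  -- a complement `B` of `K` in `ℝ[x]_s` that lies in `ℝ[x]_{s-1}`
  obtain ⟨C, hC⟩ := exists_isCompl (K ⊓ P)
  set B := C ⊓ P
  have hBP : B ≤ P := inf_le_right
  have hPB : P ≤ B ⊔ K := by
    have h1 : (K ⊓ P) ⊔ (C ⊓ P) = P := by
      rw [← sup_inf_assoc_of_le C (inf_le_right : K ⊓ P ≤ P), hC.sup_eq_top, top_inf_eq]
    calc P = (K ⊓ P) ⊔ (C ⊓ P) := h1.symm
      _ ≤ B ⊔ K := sup_le (inf_le_left.trans le_sup_right) le_sup_left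
  have hsB : Poly n s ≤ B ⊔ K := hred.trans (sup_le hPB le_sup_right)
  have hBK : Disjoint B K := by
    rw [disjoint_iff, eq_bot_iff, ← hC.inf_eq_bot]
    exact le_inf (le_inf inf_le_right (inf_le_left.trans hBP)) (inf_le_left.trans inf_le_left)
  obtain ⟨K', hKK', hBK'⟩ := hBK.symm.exists_isCompl
  let ρ : MvPolynomial (Fin n) ℝ →ₗ[ℝ] B := B.projectionOnto K' hBK'.symm
  have hρB : ∀ b : B, ρ b = b := fun b => Submodule.projectionOnto_apply_left _ b
  have hρK : ∀ k ∈ K, ρ k = 0 := fun k hk =>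
    Submodule.projectionOnto_apply_of_mem_right _ (hKK' hk)
  have hρs : ∀ p ∈ Poly n s, p - ρ p ∈ K := by
    intro p hp
    obtain ⟨b, hb, k, hk, rfl⟩ := Submodule.mem_sup.mp (hsB hp)
    rw [map_add, hρK k hk, add_zero, hρB ⟨b, hb⟩]
    simpa using hk
  let T : Fin n → Module.End ℝ B := fun i => ρ ∘ₗ LinearMap.mulLeft ℝ (X i) ∘ₗ B.subtype
  have hTa : ∀ i (b : B), T i b = ρ (X i * (b : MvPolynomial (Fin n) ℝ)) := fun _ _ => rfl
  have hρX : ∀ (b : B) i, X i * (b : MvPolynomial (Fin n) ℝ) ∈ Poly n s := fun b i =>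
    hXP _ (hBP b.2) i
  have hT : ∀ i j, T i * T j = T j * T i := by
    intro i j
    ext1 b
    rw [Module.End.mul_apply, Module.End.mul_apply, hTa, hTa, hTa, hTa, ← sub_eq_zero, ← map_sub]
    apply hρK
    have e : ∀ b u v : MvPolynomial (Fin n) ℝ,
        X i * u - X j * v = X j * (X i * b - v) - X i * (X j * b - u) := by
      intro b u v
      ring
    rw [e b]
    apply hcomm _ (hρs _ (hρX b i)) _ (hρs _ (hρX b j))
    rw [← e b]
    exact Submodule.sub_mem _ (hρX _ _) (hρX _ _)
  obtain ⟨Ψ, hΨ⟩ := exists_algHom_of_commute T hT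
  -- on `ℝ[x]_s` the orbit of `1` is given by the projection
  have horb : ∀ p ∈ Poly n s, Ψ p (ρ 1) = ρ p := by
    let A : Submodule ℝ (MvPolynomial (Fin n) ℝ) :=
      LinearMap.ker ((LinearMap.applyₗ (ρ 1)) ∘ₗ Ψ.toLinearMap - ρ)
    have hA : ∀ p, p ∈ A ↔ Ψ p (ρ 1) = ρ p := fun p => by
      rw [LinearMap.mem_ker, LinearMap.sub_apply, sub_eq_zero]
      rfl
    suffices h : ∀ k, ∀ α : Fin n →₀ ℕ, α.degree = k → k ≤ s → monomial α 1 ∈ A by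
      intro p hp
      exact (hA p).mp (poly_le_iff.mpr (fun α hα => h _ α rfl hα) hp)
    intro k
    induction k with
    | zero =>
      intro α hα _
      rw [Finsupp.degree_eq_zero_iff] at hα
      subst hα
      rw [hA, monomial_zero', C_1, map_one, Module.End.one_apply]
    | succ k ih =>
      intro α hα hk
      obtain ⟨β, i, rfl, hd⟩ := exists_eq_add_single (α := α) (by rintro rfl; simp at hα)
      have hβ := ih β (by omega) (by omega)
      have hβP : monomial β (1 : ℝ) ∈ P := monomial_mem_poly (by omega)
      rw [hA] at hβ ⊢
      rw [monomial_add_single_eq, map_mul, Module.End.mul_apply, hβ, hΨ, hTa, eq_comm,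
        ← sub_eq_zero, ← map_sub, ← mul_sub]
      apply hρK
      have h0 := hcomm _ (hρs _ (poly_mono (by omega) hβP)) 0 K.zero_mem i i
      rw [mul_zero, sub_zero] at h0
      exact h0 (hXP _ (P.sub_mem hβP (hBP (ρ _).2)) i)
  have hann : ∀ g ∈ Ideal.span (K : Set (MvPolynomial (Fin n) ℝ)), Ψ g (ρ 1) = 0 := by
    intro g hg
    induction hg using Submodule.span_induction with
    | mem x hx => rw [horb x (hK hx), hρK x hx]
    | zero => simp
    | add x y _ _ hx hy => rw [map_add, LinearMap.add_apply, hx, hy, add_zero]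
    | smul a x _ hx => rw [smul_eq_mul, map_mul, Module.End.mul_apply, hx, map_zero]
  have hker := hann f hf
  rw [horb f hfs] at hker
  simpa [hker] using hρs f hfs

/-- The span of the products `x^α g` with `|α| ≤ s` and `g ∈ K`: for `K ⊆ ℝ[x]_s`, a truncation
at degree `2s` of the ideal generated by `K`. -/
noncomputable def truncatedProducts {n : ℕ} (K : Submodule ℝ (MvPolynomial (Fin n) ℝ)) (s : ℕ) :
    Submodule ℝ (MvPolynomial (Fin n) ℝ) :=
  Submodule.span ℝ {p | ∃ α : Fin n →₀ ℕ, α.degree ≤ s ∧ ∃ g ∈ K, p = monomial α 1 * g}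

theorem monomial_mul_mem_truncatedProducts {n s : ℕ} {K : Submodule ℝ (MvPolynomial (Fin n) ℝ)}
    {α : Fin n →₀ ℕ} (hα : α.degree ≤ s) {g : MvPolynomial (Fin n) ℝ} (hg : g ∈ K) :
    monomial α 1 * g ∈ truncatedProducts K s :=
  Submodule.subset_span ⟨α, hα, g, hg, rfl⟩

theorem le_truncatedProducts {n : ℕ} (K : Submodule ℝ (MvPolynomial (Fin n) ℝ)) (s : ℕ) :
    K ≤ truncatedProducts K s := fun g hg => by
  simpa using monomial_mul_mem_truncatedProducts (s := s) (α := 0) (by simp) hg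

/-- Reduction modulo `K` of one factor at a time lowers the degree from `2s` to `s - 1`. -/
theorem poly_le_sup_truncatedProducts {n s k : ℕ} (hs : 1 ≤ s) (hk : k ≤ s)
    {K : Submodule ℝ (MvPolynomial (Fin n) ℝ)} (hred : Poly n s ≤ Poly n (s - 1) ⊔ K) :
    Poly n (s + k) ≤ Poly n (s - 1) ⊔ truncatedProducts K s := by
  induction k with
  | zero =>
    exact hred.trans (sup_le_sup_left (le_truncatedProducts K s) _)
  | succ k ih =>
    rw [poly_le_iff]
    intro α hα
    obtain ⟨β, γ, rfl, hβ, hγ⟩ := exists_eq_add_degree_le hα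
    obtain ⟨q, hq, g, hg, hqg⟩ := Submodule.mem_sup.mp (hred (monomial_mem_poly hβ))
    have e : monomial (β + γ) (1 : ℝ) = monomial γ 1 * q + monomial γ 1 * g := by
      rw [← mul_add, hqg, monomial_mul, one_mul, add_comm]
    rw [e]
    refine Submodule.add_mem _ (ih (by omega) (mul_mem_poly (monomial_mem_poly hγ) hq (by omega)))
      (Submodule.mem_sup_right (monomial_mul_mem_truncatedProducts (by omega) hg))

/-! ### Border bases -/

theorem monoSpan_eq_restrictSupport {n : ℕ} (B : Set (Fin n →₀ ℕ)) :
    monoSpan B = restrictSupport ℝ B := (restrictSupport_eq_span ..).symm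

theorem monoSpan_le_poly {n r : ℕ} {B : Set (Fin n →₀ ℕ)} (hB : DegreeLE B r) :
    monoSpan B ≤ Poly n r := by
  rw [poly_eq_span]
  exact Submodule.span_mono (Set.image_mono hB)

theorem monomial_mem_monoSpan {n : ℕ} {B : Set (Fin n →₀ ℕ)} {α : Fin n →₀ ℕ} (hα : α ∈ B) :
    monomial α (1 : ℝ) ∈ monoSpan B :=
  Submodule.subset_span ⟨α, hα, rfl⟩

/-- The monomials that are no combination of smaller ones modulo `J`, for the degree
lexicographic order, are closed under divisions and form a basis modulo `J` degree by degree. -/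
theorem exists_divisionClosed_basis {n d : ℕ} {J : Ideal (MvPolynomial (Fin n) ℝ)}
    (hJ : Poly n d ⊔ J.restrictScalars ℝ = ⊤) :
    ∃ B : Set (Fin n →₀ ℕ), DegreeLE B d ∧ DivisionClosed B ∧
      Disjoint (monoSpan B) (J.restrictScalars ℝ) ∧
      ∀ r, Poly n r ≤ monoSpan B ⊔ (Poly n r ⊓ J.restrictScalars ℝ) := by
  classical
  let ord : MonomialOrder (Fin n) := MonomialOrder.degLex
  have hdeg : ∀ α β : Fin n →₀ ℕ, ord.toSyn α < ord.toSyn β → α.degree ≤ β.degree := by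
    intro α β h
    rcases Finsupp.DegLex.lt_iff.mp (MonomialOrder.degLex_lt_iff.mp h) with h | h
    · exact h.le
    · exact h.1.le
  have hlt : ∀ α β : Fin n →₀ ℕ, α.degree < β.degree → ord.toSyn α < ord.toSyn β := fun α β h =>
    MonomialOrder.degLex_lt_iff.mpr (Finsupp.DegLex.lt_iff.mpr (Or.inl h))
  let low : (Fin n →₀ ℕ) → Submodule ℝ (MvPolynomial (Fin n) ℝ) := fun α =>
    monoSpan {β | ord.toSyn β < ord.toSyn α}
  have hmul : ∀ γ β, ∀ p ∈ low β, monomial γ (1 : ℝ) * p ∈ low (γ + β) := by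
    intro γ β p hp
    suffices h : low β ≤ (low (γ + β)).comap (LinearMap.mulLeft ℝ (monomial γ (1 : ℝ))) from h hp
    refine Submodule.span_le.mpr ?_
    rintro _ ⟨δ, hδ, rfl⟩
    change monomial γ (1 : ℝ) * monomial δ 1 ∈ low (γ + β)
    rw [monomial_mul, one_mul]
    refine monomial_mem_monoSpan ?_
    change ord.toSyn (γ + δ) < ord.toSyn (γ + β)
    rw [map_add, map_add]
    exact add_lt_add_right hδ _
  let B : Set (Fin n →₀ ℕ) := {α | monomial α (1 : ℝ) ∉ low α ⊔ J.restrictScalars ℝ}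
  refine ⟨B, ?_, ?_, ?_, ?_⟩
  · intro α hα
    by_contra! hd
    apply hα
    have h1 : Poly n d ≤ low α :=
      poly_le_iff.mpr fun β hβ => monomial_mem_monoSpan (hlt β α (hβ.trans_lt hd))
    have h2 : low α ⊔ J.restrictScalars ℝ = ⊤ :=
      eq_top_iff.mpr (hJ.symm.le.trans (sup_le_sup_right h1 _))
    rw [h2]
    trivial
  · intro α hα β hβα hβ
    apply hα
    obtain ⟨l, hl, j, hj, hlj⟩ := Submodule.mem_sup.mp hβ
    have e : monomial α (1 : ℝ) = monomial (α - β) 1 * l + monomial (α - β) 1 * j := by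
      rw [← mul_add, hlj, monomial_mul, one_mul, tsub_add_cancel_of_le hβα]
    rw [e]
    refine Submodule.add_mem _ (Submodule.mem_sup_left ?_)
      (Submodule.mem_sup_right (J.mul_mem_left _ hj))
    have h1 := hmul (α - β) β l hl
    rwa [tsub_add_cancel_of_le hβα] at h1
  · rw [Submodule.disjoint_def]
    intro p hp hpJ
    by_contra h0
    -- the leading exponent of `p` would not be in `B`
    have hα : ord.degree p ∈ p.support := ord.degree_mem_support h0
    rw [monoSpan_eq_restrictSupport, mem_restrictSupport_iff] at hp
    refine hp hα ?_
    have hc : coeff (ord.degree p) p ≠ 0 := mem_support_iff.mp hα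
    have hl : p - monomial (ord.degree p) (coeff (ord.degree p) p) ∈ low (ord.degree p) := by
      change _ ∈ monoSpan _
      rw [monoSpan_eq_restrictSupport, mem_restrictSupport_iff]
      intro β hβ
      rw [Finset.mem_coe, mem_support_iff, coeff_sub, coeff_monomial] at hβ
      have hne : ord.degree p ≠ β := by
        rintro rfl
        simp at hβ
      rw [if_neg hne, sub_zero] at hβ
      exact lt_of_le_of_ne (ord.le_degree (mem_support_iff.mpr hβ))
        fun h => hne (ord.toSyn.injective h).symm
    have e : monomial (ord.degree p) (1 : ℝ) = (coeff (ord.degree p) p)⁻¹ • p -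
        (coeff (ord.degree p) p)⁻¹ • (p - monomial (ord.degree p) (coeff (ord.degree p) p)) := by
      rw [← smul_sub, sub_sub_cancel, smul_monomial, smul_eq_mul, inv_mul_cancel₀ hc]
    rw [e]
    exact Submodule.sub_mem _
      (Submodule.mem_sup_right (Submodule.smul_mem (J.restrictScalars ℝ) _ hpJ))
      (Submodule.mem_sup_left (Submodule.smul_mem _ _ hl))
  · intro r
    rw [poly_le_iff]
    intro α
    induction hx : ord.toSyn α using WellFoundedLT.induction generalizing α with
    | ind x ih =>
      subst hx
      intro hα
      by_cases hB : α ∈ B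
      · exact Submodule.mem_sup_left (monomial_mem_monoSpan hB)
      · obtain ⟨l, hl, j, hj, hlj⟩ := Submodule.mem_sup.mp (not_not.mp hB)
        have hlr : low α ≤ Poly n r := monoSpan_le_poly fun β hβ => (hdeg β α hβ).trans hα
        have hjr : j ∈ Poly n r := by
          rw [← add_sub_cancel_left l j, hlj]
          exact Submodule.sub_mem _ (monomial_mem_poly hα) (hlr hl)
        rw [← hlj]
        refine Submodule.add_mem _ ?_ (Submodule.mem_sup_right ⟨hjr, hj⟩)
        suffices h : low α ≤ monoSpan B ⊔ (Poly n r ⊓ J.restrictScalars ℝ) from h hl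
        refine Submodule.span_le.mpr ?_
        rintro _ ⟨β, hβ, rfl⟩
        exact ih _ hβ β rfl ((hdeg β α hβ).trans hα)

/-- If `ℝ[x]_r ∩ Span(G)` is the degree `r` part of an ideal `J`, the border relations of any
`B` that decomposes `ℝ[x]_r` generate `J`: modulo the border relations every polynomial lies in
`Span(B)`, which meets `J` only in `0`. -/
theorem eq_span_borderFamily {n r : ℕ} (hr : 1 ≤ r) {G : Set (MvPolynomial (Fin n) ℝ)}
    {J : Ideal (MvPolynomial (Fin n) ℝ)}
    (hG : Poly n r ⊓ Submodule.span ℝ G = Poly n r ⊓ J.restrictScalars ℝ)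
    {B : Set (Fin n →₀ ℕ)} (hB : DegreeLE B (r - 1)) (hdec : Decomposes G r B) :
    J = Ideal.span (borderFamily G r B) := by
  have hfam : Ideal.span (borderFamily G r B) ≤ J := by
    rw [Ideal.span_le]
    rintro f ⟨α, _, q, _, _, hf⟩
    rw [hG] at hf
    exact hf.2
  refine le_antisymm ?_ hfam
  have hBr : monoSpan B ≤ Poly n r := (monoSpan_le_poly hB).trans (poly_mono (by omega))
  have hborder : ∀ α : Fin n →₀ ℕ, α.degree ≤ r →
      (α = 0 ∨ ∃ i, ∃ β ∈ B, α = β + Finsupp.single i 1) →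
      monomial α (1 : ℝ) ∈
        monoSpan B ⊔ (Ideal.span (borderFamily G r B)).restrictScalars ℝ := by
    intro α hα h
    by_cases hαB : α ∈ B
    · exact Submodule.mem_sup_left (monomial_mem_monoSpan hαB)
    · have hm : monomial α (1 : ℝ) ∈ Poly n r := monomial_mem_poly hα
      rw [← hdec.2] at hm
      obtain ⟨q, hq, g, hg, hqg⟩ := Submodule.mem_sup.mp hm
      rw [← hqg]
      refine Submodule.add_mem_sup hq (Ideal.subset_span ⟨α, ⟨h, hαB⟩, q, hq, ?_, hg⟩)
      rw [← hqg, add_sub_cancel_left]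
  have htop := sup_ideal_eq_top (W := monoSpan B) (J := Ideal.span (borderFamily G r B))
    (hborder 0 (by simp) (Or.inl rfl)) (by
      intro w hw i
      suffices h : monoSpan B ≤ (monoSpan B ⊔
          (Ideal.span (borderFamily G r B)).restrictScalars ℝ).comap
          (LinearMap.mulLeft ℝ (X i)) from h hw
      rw [monoSpan, Submodule.span_le]
      rintro _ ⟨β, hβ, rfl⟩
      change X i * monomial β (1 : ℝ) ∈ monoSpan B ⊔ _
      rw [← monomial_add_single_eq]
      refine hborder _ ?_ (Or.inr ⟨i, β, hβ, rfl⟩)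
      have := hB β hβ
      rw [map_add, Finsupp.degree_single]
      omega)
  intro f hf
  obtain ⟨b, hb, g, hg, rfl⟩ := Submodule.mem_sup.mp (htop.symm.le (Submodule.mem_top (x := f)))
  have hbJ : b ∈ J := by
    have := J.sub_mem hf (hfam hg)
    rwa [add_sub_cancel_right] at this
  have hb0 : b = 0 := by
    refine (Submodule.disjoint_def.mp hdec.1) b hb ?_
    rw [hG]
    exact ⟨hBr hb, hbJ⟩
  rw [hb0, zero_add]
  exact hg

/-- An ideal `J` that agrees with `Span(G)` in degree `r`, and modulo which the polynomials of
some degree `d ≤ r - 1` suffice, is the border ideal at order `r`. -/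
theorem isBorderIdeal_of_inf_eq {n r d : ℕ} (hr : 1 ≤ r) (hd : d ≤ r - 1)
    {G : Set (MvPolynomial (Fin n) ℝ)} {J : Ideal (MvPolynomial (Fin n) ℝ)}
    (hJ : Poly n d ⊔ J.restrictScalars ℝ = ⊤)
    (hG : Poly n r ⊓ Submodule.span ℝ G = Poly n r ⊓ J.restrictScalars ℝ) :
    IsBorderIdeal G r J := by
  refine ⟨?_, fun B hB _ hdec => eq_span_borderFamily hr hG hB hdec⟩
  obtain ⟨B, hBd, hBc, hdisj, hsup⟩ := exists_divisionClosed_basis hJ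
  have hBr : DegreeLE B (r - 1) := fun α hα => (hBd α hα).trans hd
  refine ⟨B, hBr, hBc, ?_, ?_⟩
  · rw [hG]
    exact hdisj.mono_right inf_le_right
  · rw [hG]
    exact le_antisymm (sup_le ((monoSpan_le_poly hBr).trans (poly_mono (by omega))) inf_le_left)
      (hsup r)

/-! ### Column bases of moment matrices -/

/-- The columns of `M_s(L)` are the images of the monomials under `p ↦ M_s(L) vec(p)`, whose
kernel on `ℝ[x]_s` is `Ker M_s(L)`. -/
theorem decomposes_iff_isColumnBasis {n s t : ℕ} {hst : 2 * s ≤ t}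
    {L : Module.Dual ℝ (Poly n t)} {G : Set (MvPolynomial (Fin n) ℝ)}
    (hG : Poly n s ⊓ Submodule.span ℝ G = momentKer hst L) {B : Set (Fin n →₀ ℕ)}
    (hB : DegreeLE B s) : Decomposes G s B ↔ IsColumnBasis hst L B := by
  classical
  set c := (momentMatrix hst L).mulVecLin ∘ₗ vec n s with hc
  have hBs : monoSpan B ≤ Poly n s := monoSpan_le_poly hB
  have hcol : ∀ β : Expo n s, c (monomial β.1 1) = (momentMatrix hst L).col β := by
    intro β
    have h1 : vec n s (monomial β.1 (1 : ℝ)) = Pi.single β 1 := by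
      funext α
      simp only [vec, LinearMap.pi_apply, lcoeff_apply, coeff_monomial, Pi.single_apply,
        Subtype.ext_iff, eq_comm]
    rw [hc, LinearMap.comp_apply, h1, Matrix.mulVecLin_apply, Matrix.mulVec_single_one]
  have hspanB : Submodule.span ℝ ((momentMatrix hst L).col '' {b : Expo n s | b.1 ∈ B}) =
      (monoSpan B).map c := by
    rw [monoSpan, Submodule.map_span, Set.image_image]
    congr 1
    ext x
    constructor
    · rintro ⟨b, hb, rfl⟩
      exact ⟨b.1, hb, hcol b⟩
    · rintro ⟨b, hb, rfl⟩
      exact ⟨⟨b, hB b hb⟩, hb, (hcol _).symm⟩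
  have hspan : Submodule.span ℝ (Set.range (momentMatrix hst L).col) = (Poly n s).map c := by
    rw [poly_eq_span, Submodule.map_span, Set.image_image]
    congr 1
    ext x
    constructor
    · rintro ⟨b, rfl⟩
      exact ⟨b.1, b.2, hcol b⟩
    · rintro ⟨b, hb, rfl⟩
      exact ⟨⟨b, hb⟩, (hcol _).symm⟩
  have hker : momentKer hst L = Poly n s ⊓ LinearMap.ker c := rfl
  let v : {b : Expo n s // b.1 ∈ B} → MvPolynomial (Fin n) ℝ := fun b => monomial b.1.1 1
  have hv : LinearIndependent ℝ v :=
    (basisMonomials (Fin n) ℝ).linearIndependent.comp (fun b : {b : Expo n s // b.1 ∈ B} => b.1.1)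
      (fun b b' h => Subtype.ext (Subtype.ext h))
  have hvspan : Submodule.span ℝ (Set.range v) = monoSpan B := by
    rw [monoSpan]
    congr 1
    ext x
    constructor
    · rintro ⟨b, rfl⟩
      exact ⟨b.1.1, b.2, rfl⟩
    · rintro ⟨b, hb, rfl⟩
      exact ⟨⟨⟨b, hB b hb⟩, hb⟩, rfl⟩
  have hcv : (fun b : {b : Expo n s // b.1 ∈ B} => (momentMatrix hst L).col b.1) = c ∘ v :=
    funext fun b => (hcol b.1).symm
  rw [Decomposes, IsColumnBasis, hG, hspanB, hspan, hcv, hker]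
  refine and_congr ?_ ?_
  · rw [← disjoint_assoc, inf_eq_left.mpr hBs, ← hvspan]
    constructor
    · exact fun h => hv.map h
    · intro h
      rw [Submodule.disjoint_def]
      intro x hx hx0
      obtain ⟨y, rfl⟩ := (Finsupp.range_linearCombination ℝ (v := v)).symm.le hx
      rw [LinearMap.mem_ker, Finsupp.apply_linearCombination] at hx0
      rw [(linearIndependent_iff.mp h) y hx0, map_zero]
  · constructor
    · intro h
      refine le_antisymm (Submodule.map_mono hBs) ?_
      conv_lhs => rw [← h, Submodule.map_sup]
      refine sup_le le_rfl ?_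
      rintro _ ⟨x, hx, rfl⟩
      rw [LinearMap.mem_ker.mp hx.2]
      exact zero_mem _
    · intro h
      refine le_antisymm (sup_le hBs inf_le_left) fun p hp => ?_
      obtain ⟨b, hb, hbp⟩ := h.symm.le (Submodule.mem_map_of_mem hp)
      rw [← add_sub_cancel b p]
      refine Submodule.add_mem_sup hb ⟨Submodule.sub_mem _ hp (hBs hb), ?_⟩
      change c (p - b) = 0
      rw [map_sub, hbp, sub_self]

/-! ### Flat moment matrices -/

section

variable {n s t : ℕ} {L : Module.Dual ℝ (Poly n t)} {ℓ : MvPolynomial (Fin n) ℝ →ₗ[ℝ] ℝ}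

theorem truncatedProducts_le_ideal (K : Submodule ℝ (MvPolynomial (Fin n) ℝ)) (s : ℕ) :
    truncatedProducts K s ≤
      (Ideal.span (K : Set (MvPolynomial (Fin n) ℝ))).restrictScalars ℝ := by
  refine Submodule.span_le.mpr ?_
  rintro _ ⟨α, _, g, hg, rfl⟩
  exact Ideal.mul_mem_left _ _ (Ideal.subset_span hg)

theorem poly_sup_span_momentKer_eq_top {hst : 2 * s ≤ t} (hs : 1 ≤ s)
    (hflat : Poly n s ≤ Poly n (s - 1) ⊔ momentKer hst L) :
    Poly n (s - 1) ⊔ (Ideal.span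
      (momentKer hst L : Set (MvPolynomial (Fin n) ℝ))).restrictScalars ℝ = ⊤ := by
  refine sup_ideal_eq_top (Submodule.mem_sup_left (one_mem_poly _ _)) fun w hw i => ?_
  have h1 : X i * w ∈ Poly n s := mul_mem_poly (X_mem_poly i) hw (by omega)
  have hle : momentKer hst L ≤ (Ideal.span
      (momentKer hst L : Set (MvPolynomial (Fin n) ℝ))).restrictScalars ℝ :=
    fun g hg => Ideal.subset_span hg
  exact sup_le_sup le_rfl hle (hflat h1)

/-- The ideal generated by the kernel of a flat moment matrix does not grow in degree `s`. -/
theorem mem_momentKer_of_mem_span {hst : 2 * s ≤ t} (hs : 1 ≤ s)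
    (hflat : Poly n s ≤ Poly n (s - 1) ⊔ momentKer hst L) {f : MvPolynomial (Fin n) ℝ}
    (hf : f ∈ Ideal.span (momentKer hst L : Set (MvPolynomial (Fin n) ℝ)))
    (hfs : f ∈ Poly n s) : f ∈ momentKer hst L := by
  obtain ⟨ℓ, hℓ⟩ := exists_extend_form L
  refine mem_of_mem_span_of_mem_poly (K := momentKer hst L) hs inf_le_left hflat ?_ hf hfs
  intro p hp q hq i j hpq
  rw [mem_momentKer_iff hℓ] at hp hq ⊢
  refine ⟨hpq, fun v hv => ?_⟩
  -- modulo the kernel `v` has degree at most `s - 1`, so that `x_i v` and `x_j v` are tested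
  obtain ⟨w, hw, g, hg, rfl⟩ := Submodule.mem_sup.mp (hflat hv)
  rw [mem_momentKer_iff hℓ] at hg
  have e : (w + g) * (X i * p - X j * q) =
      (X i * w) * p - (X j * w) * q + (X i * p - X j * q) * g := by ring
  rw [e, map_add, map_sub, hg.2 _ hpq,
    hp.2 _ (mul_mem_poly (X_mem_poly i) hw (by omega)),
    hq.2 _ (mul_mem_poly (X_mem_poly j) hw (by omega))]
  ring

theorem mem_truncatedProducts_of_mem_span {hst : 2 * s ≤ t} (hs : 1 ≤ s)
    (hflat : Poly n s ≤ Poly n (s - 1) ⊔ momentKer hst L) {f : MvPolynomial (Fin n) ℝ}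
    (hf : f ∈ Ideal.span (momentKer hst L : Set (MvPolynomial (Fin n) ℝ)))
    (hfs : f ∈ Poly n (2 * s)) : f ∈ truncatedProducts (momentKer hst L) s := by
  have h1 := poly_le_sup_truncatedProducts hs (le_refl s) hflat
  rw [← two_mul] at h1
  obtain ⟨q, hq, τ, hτ, rfl⟩ := Submodule.mem_sup.mp (h1 hfs)
  have hqJ := Ideal.sub_mem _ hf (truncatedProducts_le_ideal _ _ hτ)
  rw [add_sub_cancel_right] at hqJ
  exact Submodule.add_mem _ (le_truncatedProducts _ _
    (mem_momentKer_of_mem_span hs hflat hqJ (poly_mono (by omega) hq))) hτ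

theorem apply_eq_zero_of_mem_truncatedProducts {hst : 2 * s ≤ t}
    (hℓ : ∀ p : Poly n t, ℓ p = L p) {f : MvPolynomial (Fin n) ℝ}
    (hf : f ∈ truncatedProducts (momentKer hst L) s) : ℓ f = 0 := by
  suffices h : truncatedProducts (momentKer hst L) s ≤ LinearMap.ker ℓ from h hf
  refine Submodule.span_le.mpr ?_
  rintro _ ⟨α, hα, g, hg, rfl⟩
  exact ((mem_momentKer_iff hℓ).mp hg).2 _ (monomial_mem_poly hα)

/-- The ideal generated by the kernel of a flat positive semidefinite moment matrix is real
radical: a sum of squares in it can be reduced to one of polynomials of degree at most `s - 1`,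
on which the linear form vanishes, so that each of the squares lies in the kernel. -/
theorem span_momentKer_eq_realRadical {hst : 2 * s ≤ t} (hs : 1 ≤ s)
    (hL : (momentMatrix hst L).PosSemidef)
    (hflat : Poly n s ≤ Poly n (s - 1) ⊔ momentKer hst L) :
    (Ideal.span (momentKer hst L : Set (MvPolynomial (Fin n) ℝ)) :
      Set (MvPolynomial (Fin n) ℝ)) =
      realRadical (Ideal.span (momentKer hst L : Set (MvPolynomial (Fin n) ℝ))) := by
  obtain ⟨ℓ, hℓ⟩ := exists_extend_form L
  have hpos := (momentMatrix_posSemidef_iff hℓ).mp hL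
  have htop := poly_sup_span_momentKer_eq_top hs hflat
  set J := Ideal.span (momentKer hst L : Set (MvPolynomial (Fin n) ℝ)) with hJ
  have hred : ∀ p, ∃ r ∈ Poly n s, p - r ∈ J ∧ p * p - r * r ∈ J := by
    intro p
    obtain ⟨r, hr, j, hj, rfl⟩ := Submodule.mem_sup.mp (htop.symm.le (Submodule.mem_top (x := p)))
    refine ⟨r, poly_mono (by omega) hr, by simpa using hj, ?_⟩
    rw [show (r + j) * (r + j) - r * r = (2 * r + j) * j by ring]
    exact J.mul_mem_left _ hj
  have hsq : ∀ r ∈ Poly n s, r * r ∈ Poly n (2 * s) := fun r hr =>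
    mul_mem_poly hr hr (by omega)
  apply eq_realRadical_of_sq_add
  intro p q hq hpq
  have hq' : ∃ r ∈ Poly n (2 * s), q - r ∈ J ∧ 0 ≤ ℓ r := by
    clear hpq
    induction hq with
    | zero => exact ⟨0, zero_mem _, by simp, by simp⟩
    | sq_add a _ ih =>
      obtain ⟨u, hu, huJ, hu0⟩ := ih
      obtain ⟨r, hr, -, hrJ⟩ := hred a
      refine ⟨r * r + u, Submodule.add_mem _ (hsq r hr) hu, ?_, ?_⟩
      · rw [add_sub_add_comm]
        exact J.add_mem hrJ huJ
      · rw [map_add]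
        exact add_nonneg (hpos r hr) hu0
  obtain ⟨u, hu, huJ, hu0⟩ := hq'
  obtain ⟨r, hr, hpr, hrJ⟩ := hred p
  have hmem : r * r + u ∈ J := by
    have e : r * r + u = (p ^ 2 + q) - ((p * p - r * r) + (q - u)) := by ring
    rw [e]
    exact J.sub_mem hpq (J.add_mem hrJ huJ)
  have h0 := apply_eq_zero_of_mem_truncatedProducts hℓ
    (mem_truncatedProducts_of_mem_span hs hflat hmem (Submodule.add_mem _ (hsq r hr) hu))
  rw [map_add] at h0
  have hr0 : ℓ (r * r) = 0 := le_antisymm (by linarith) (hpos r hr)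
  have hrK : r ∈ J := Ideal.subset_span ((mem_momentKer_iff_sq hℓ hL).mpr ⟨hr, hr0⟩)
  rw [← sub_add_cancel p r]
  exact J.add_mem hpr hrK

theorem rankCondition_iff (hst : s ≤ t / 2)
    (hL : (momentMatrix (Nat.mul_div_le t 2) L).PosSemidef) :
    RankCondition hst L ↔ Poly n s ≤ Poly n (s - 1) ⊔ momentKer (two_mul_le hst) L := by
  have h1 := momentKer_eq_inf (hst := two_mul_le hst) hst hL
  have h2 := momentKer_eq_inf (hst := two_mul_pred_le hst) ((Nat.sub_le s 1).trans hst) hL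
  rw [h1, RankCondition]
  refine le_sup_iff_of_finrank (poly_mono (Nat.sub_le s 1)) ?_ ?_
  · rw [← h1]
    exact rank_momentMatrix_add_finrank_momentKer
  · rw [← h2]
    exact rank_momentMatrix_add_finrank_momentKer

end

/-! ### The system of a generic linear form -/

section

variable {n m : ℕ} {h : Fin m → MvPolynomial (Fin n) ℝ} {t s : ℕ} {L : Module.Dual ℝ (Poly n t)}

theorem IsGeneric.system_subset_poly (hL : IsGeneric h t L) : system h t ⊆ Poly n t := by
  rintro _ (⟨α, j, hα, rfl⟩ | ⟨α, g, hα, hg, rfl⟩)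
  · exact mul_mem_poly (monomial_mem_poly le_rfl) ((mem_restrictTotalDegree _ _ _).mpr le_rfl) hα
  · rw [genericKer_eq hL] at hg
    exact mul_mem_poly (monomial_mem_poly hα) hg.1 (by omega)

theorem IsGeneric.truncatedProducts_le_span_system (hL : IsGeneric h t L) (hst : s ≤ t / 2) :
    truncatedProducts (momentKer (two_mul_le hst) L) s ≤ Submodule.span ℝ (system h t) := by
  refine Submodule.span_mono ?_
  rintro _ ⟨α, hα, g, hg, rfl⟩
  rw [momentKer_eq_inf hst hL.1.2] at hg
  refine Or.inr ⟨α, g, hα.trans hst, ?_, rfl⟩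
  rw [genericKer_eq hL]
  exact hg.2

theorem IsGeneric.apply_eq_zero_of_mem_span_system (hL : IsGeneric h t L)
    {ℓ : MvPolynomial (Fin n) ℝ →ₗ[ℝ] ℝ} (hℓ : ∀ p : Poly n t, ℓ p = L p)
    {f : MvPolynomial (Fin n) ℝ} (hf : f ∈ Submodule.span ℝ (system h t)) : ℓ f = 0 := by
  suffices h : Submodule.span ℝ (system h t) ≤ LinearMap.ker ℓ from h hf
  refine Submodule.span_le.mpr fun p hp => ?_
  rcases hp with hp | ⟨α, g, hα, hg, rfl⟩
  · exact (hℓ ⟨p, hL.system_subset_poly (Or.inl hp)⟩).trans (hL.1.1 _ hp)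
  · rw [genericKer_eq hL] at hg
    exact ((mem_momentKer_iff hℓ).mp hg).2 _ (monomial_mem_poly hα)

theorem IsGeneric.idealOf_le_span_momentKer (hL : IsGeneric h t L) (hst : s ≤ t / 2)
    (hD : maxDegree h ≤ s) :
    idealOf h ≤ Ideal.span
      (momentKer (two_mul_le hst) L : Set (MvPolynomial (Fin n) ℝ)) := by
  obtain ⟨ℓ, hℓ⟩ := exists_extend_form L
  rw [idealOf, Ideal.span_le]
  rintro _ ⟨j, rfl⟩
  apply Ideal.subset_span
  have hj : (h j).totalDegree ≤ s :=
    (Finset.le_sup (f := fun j => (h j).totalDegree) (Finset.mem_univ j)).trans hD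
  refine (mem_momentKer_iff hℓ).mpr ⟨(mem_restrictTotalDegree _ _ _).mpr hj, fun q hq => ?_⟩
  suffices hle : Poly n s ≤ LinearMap.ker (ℓ ∘ₗ LinearMap.mulRight ℝ (h j)) from hle hq
  rw [poly_le_iff]
  intro α hα
  exact hL.apply_eq_zero_of_mem_span_system hℓ
    (Submodule.subset_span (Or.inl ⟨α, j, by omega, rfl⟩))

theorem IsGeneric.span_momentKer_le_realRadicalIdeal (hL : IsGeneric h t L) (hst : s ≤ t / 2) :
    Ideal.span (momentKer (two_mul_le hst) L : Set (MvPolynomial (Fin n) ℝ)) ≤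
      realRadicalIdeal (idealOf h) := by
  rw [Ideal.span_le]
  intro p hp
  rw [momentKer_eq_inf hst hL.1.2] at hp
  exact hL.momentKer_le_realRadical hp.2

/-- When the degrees of the `h_j` do not exceed `s`, flatness identifies the ideal generated by
the kernel with the real radical of `I`: it is a real radical ideal between `I` and the real
radical of `I`. -/
theorem IsGeneric.span_momentKer_eq_realRadical_idealOf (hL : IsGeneric h t L) (hs : 1 ≤ s)
    (hst : s ≤ t / 2) (hD : maxDegree h ≤ s)
    (hflat : Poly n s ≤ Poly n (s - 1) ⊔ momentKer (two_mul_le hst) L) :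
    (Ideal.span (momentKer (two_mul_le hst) L : Set (MvPolynomial (Fin n) ℝ)) :
      Set (MvPolynomial (Fin n) ℝ)) = realRadical (idealOf h) := by
  refine Set.Subset.antisymm (hL.span_momentKer_le_realRadicalIdeal hst) ?_
  rw [span_momentKer_eq_realRadical hs (momentMatrix_posSemidef_of_le hst hL.1.2) hflat]
  exact realRadical_mono (hL.idealOf_le_span_momentKer hst hD)

theorem IsGeneric.projectionCondition_iff (hL : IsGeneric h t L) (hst : s ≤ t / 2) :
    ProjectionCondition hst (system h t) ↔
      Poly n (2 * s) ≤
        Poly n (s - 1) ⊔ (Poly n (2 * s) ⊓ Submodule.span ℝ (system h t)) :=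
  le_sup_iff_of_finrank (poly_mono (by omega))
    (dimProj_add_finrank _ hL.system_subset_poly) (dimProj_add_finrank _ hL.system_subset_poly)

theorem X_mul_mem_span_prolong {G : Set (MvPolynomial (Fin n) ℝ)} {f : MvPolynomial (Fin n) ℝ}
    (hf : f ∈ Submodule.span ℝ G) (i : Fin n) : X i * f ∈ Submodule.span ℝ (prolong G) := by
  suffices hle : Submodule.span ℝ G ≤
      (Submodule.span ℝ (prolong G)).comap (LinearMap.mulLeft ℝ (X i)) from hle hf
  exact Submodule.span_le.mpr fun g hg => Submodule.subset_span (Or.inr ⟨i, g, hg, rfl⟩)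

theorem IsGeneric.prolongationCondition_iff (hL : IsGeneric h t L) (hst : s ≤ t / 2) :
    ProlongationCondition hst (system h t) ↔
      Poly n (2 * s) ⊓ Submodule.span ℝ (prolong (system h t)) ≤
        Submodule.span ℝ (system h t) := by
  have hG : prolong (system h t) ⊆ Poly n (t + 1) := by
    rintro _ (hg | ⟨i, g, hg, rfl⟩)
    · exact poly_mono (by omega) (hL.system_subset_poly hg)
    · exact mul_mem_poly (X_mem_poly i) (hL.system_subset_poly hg) (by omega)
  have h1 := dimProj_add_finrank (two_mul_le hst) hL.system_subset_poly
  have h2 := dimProj_add_finrank (two_mul_le_succ hst) hG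
  have hle : Poly n (2 * s) ⊓ Submodule.span ℝ (system h t) ≤
      Poly n (2 * s) ⊓ Submodule.span ℝ (prolong (system h t)) :=
    inf_le_inf_left _ (Submodule.span_mono Set.subset_union_left)
  have : FiniteDimensional ℝ
      (Poly n (2 * s) ⊓ Submodule.span ℝ (prolong (system h t)) : Submodule ℝ _) :=
    Submodule.finiteDimensional_of_le inf_le_left
  rw [ProlongationCondition]
  constructor
  · intro h0
    exact (Submodule.eq_of_le_of_finrank_eq hle (by omega)).ge.trans inf_le_right
  · intro h0
    rw [le_antisymm (le_inf inf_le_left h0) hle] at h2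
    omega

/-- Under the prolongation condition, a polynomial `p` of degree at most `s` in the span of the
system has all its multiples of degree at most `2s` in that span, in particular `p^2`. -/
theorem IsGeneric.inf_span_system_eq_momentKer (hL : IsGeneric h t L) (hst : s ≤ t / 2)
    (hb : Poly n (2 * s) ⊓ Submodule.span ℝ (prolong (system h t)) ≤
      Submodule.span ℝ (system h t)) :
    Poly n s ⊓ Submodule.span ℝ (system h t) = momentKer (two_mul_le hst) L := by
  obtain ⟨ℓ, hℓ⟩ := exists_extend_form L
  apply le_antisymm
  · rintro p ⟨hp, hpG⟩
    rw [mem_momentKer_iff_sq hℓ (momentMatrix_posSemidef_of_le hst hL.1.2)]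
    refine ⟨hp, hL.apply_eq_zero_of_mem_span_system hℓ ?_⟩
    suffices hmul : ∀ k, ∀ α : Fin n →₀ ℕ, α.degree = k → k ≤ s →
        monomial α 1 * p ∈ Submodule.span ℝ (system h t) by
      have hle : Poly n s ≤
          (Submodule.span ℝ (system h t)).comap (LinearMap.mulRight ℝ p) :=
        poly_le_iff.mpr fun α hα => hmul _ α rfl hα
      exact hle hp
    intro k
    induction k with
    | zero =>
      intro α hα _
      rw [Finsupp.degree_eq_zero_iff] at hα
      subst hα
      rwa [monomial_zero', C_1, one_mul]
    | succ k ih =>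
      intro α hα hk
      obtain ⟨β, i, rfl, hd⟩ := exists_eq_add_single (α := α) (by rintro rfl; simp at hα)
      refine hb ⟨mul_mem_poly (monomial_mem_poly hα.le) hp (by omega), ?_⟩
      rw [monomial_add_single_eq, mul_assoc]
      exact X_mul_mem_span_prolong (ih β (by omega) (by omega)) i
  · exact le_inf inf_le_left
      ((le_truncatedProducts _ s).trans (hL.truncatedProducts_le_span_system hst))

end

end MomentProlongation

open MomentProlongation in
theorem proposition4p3 {n m : ℕ} (h : Fin m → MvPolynomial (Fin n) ℝ) (t s : ℕ)
    (hs : 1 ≤ s) (hst : s ≤ t / 2)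
    (L : Module.Dual ℝ (MomentProlongation.Poly n t))
    (hL : MomentProlongation.IsGeneric h t L) :
    (MomentProlongation.RankCondition hst L →
      MomentProlongation.ProjectionCondition hst (MomentProlongation.system h t) ∧
      (MomentProlongation.maxDegree h ≤ s →
        MomentProlongation.ProlongationCondition hst (MomentProlongation.system h t))) ∧
    (MomentProlongation.ProjectionCondition hst (MomentProlongation.system h t) →
      MomentProlongation.ProlongationCondition hst (MomentProlongation.system h t) →
      MomentProlongation.RankCondition hst L ∧
      ∃ J : Ideal (MvPolynomial (Fin n) ℝ),
        MomentProlongation.IsBorderIdeal (MomentProlongation.system h t) s J ∧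
        MomentProlongation.IsBorderIdeal (MomentProlongation.system h t) (2 * s) J ∧
        (J : Set (MvPolynomial (Fin n) ℝ)) = MomentProlongation.realRadical J ∧
        J = Ideal.span
          (MomentProlongation.momentKer (MomentProlongation.two_mul_le hst) L :
            Set (MvPolynomial (Fin n) ℝ)) ∧
        J ≤ MvPolynomial.vanishingIdeal ℝ
          (MvPolynomial.zeroLocus ℝ (MomentProlongation.idealOf h)) ∧
        (∀ B : Set (Fin n →₀ ℕ), MomentProlongation.DegreeLE B (s - 1) →
          (MomentProlongation.Decomposes (MomentProlongation.system h t) (s - 1) B ↔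
            MomentProlongation.IsColumnBasis (MomentProlongation.two_mul_pred_le hst) L B)) ∧
        (MomentProlongation.maxDegree h ≤ s →
          (J : Set (MvPolynomial (Fin n) ℝ)) =
            MomentProlongation.realRadical (MomentProlongation.idealOf h))) := by
  have hpsd := momentMatrix_posSemidef_of_le (hst := two_mul_le hst) hst hL.1.2
  have hTG := hL.truncatedProducts_le_span_system hst
  rw [rankCondition_iff hst hL.1.2, hL.projectionCondition_iff hst,
    hL.prolongationCondition_iff hst]
  constructor
  · intro hflat
    constructor
    · intro p hp
      have h1 := poly_le_sup_truncatedProducts hs (le_refl s) hflat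
      rw [← two_mul] at h1
      obtain ⟨q, hq, τ, hτ, rfl⟩ := Submodule.mem_sup.mp (h1 hp)
      refine Submodule.add_mem_sup hq ⟨?_, hTG hτ⟩
      have h2 := Submodule.sub_mem _ hp (poly_mono (by omega : s - 1 ≤ 2 * s) hq)
      rwa [add_sub_cancel_left] at h2
    · rintro hD f ⟨hfs, hf⟩
      refine hTG (mem_truncatedProducts_of_mem_span hs hflat ?_ hfs)
      have hJ := hL.span_momentKer_eq_realRadical_idealOf hs hst hD hflat
      set J := Ideal.span (momentKer (two_mul_le hst) L : Set (MvPolynomial (Fin n) ℝ))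
      have hGJ : system h t ⊆ J := by
        rintro _ (⟨α, j, _, rfl⟩ | ⟨α, g, _, hg, rfl⟩)
        · exact J.mul_mem_left _
            (hL.idealOf_le_span_momentKer hst hD (Ideal.subset_span ⟨j, rfl⟩))
        · refine J.mul_mem_left _ ?_
          rw [genericKer_eq hL] at hg
          exact hJ.symm.subset (hL.momentKer_le_realRadical hg)
      have hle : Submodule.span ℝ (prolong (system h t)) ≤ J.restrictScalars ℝ := by
        refine Submodule.span_le.mpr ?_
        rintro _ (hg | ⟨i, g, hg, rfl⟩)
        · exact hGJ hg
        · exact J.mul_mem_left _ (hGJ hg)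
      exact hle hf
  · intro ha hb
    have hK := hL.inf_span_system_eq_momentKer hst hb
    have hflat : Poly n s ≤ Poly n (s - 1) ⊔ momentKer (two_mul_le hst) L := by
      intro p hp
      obtain ⟨q, hq, g, hg, rfl⟩ := Submodule.mem_sup.mp (ha (poly_mono (by omega) hp))
      refine Submodule.add_mem_sup hq (hK.le ⟨?_, hg.2⟩)
      have h2 := Submodule.sub_mem _ hp (poly_mono (by omega : s - 1 ≤ s) hq)
      rwa [add_sub_cancel_left] at h2
    have htop := poly_sup_span_momentKer_eq_top hs hflat
    refine ⟨hflat, Ideal.span (momentKer (two_mul_le hst) L : Set (MvPolynomial (Fin n) ℝ)),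
      isBorderIdeal_of_inf_eq hs le_rfl htop ?_,
      isBorderIdeal_of_inf_eq (by omega) (by omega : s - 1 ≤ 2 * s - 1) htop ?_,
      span_momentKer_eq_realRadical hs hpsd hflat, rfl,
      (hL.span_momentKer_le_realRadicalIdeal hst).trans (realRadical_le_vanishingIdeal _), ?_,
      fun hD => hL.span_momentKer_eq_realRadical_idealOf hs hst hD hflat⟩
    · rw [hK]
      exact le_antisymm (le_inf inf_le_left fun g hg => Ideal.subset_span hg)
        fun f hf => mem_momentKer_of_mem_span hs hflat hf.2 hf.1
    · apply le_antisymm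
      · rintro f ⟨hfs, hfG⟩
        have h1 := poly_le_sup_truncatedProducts hs (le_refl s) hflat
        rw [← two_mul] at h1
        refine ⟨hfs, ?_⟩
        obtain ⟨q, hq, τ, hτ, rfl⟩ := Submodule.mem_sup.mp (h1 hfs)
        have hqG := Submodule.sub_mem _ hfG (hTG hτ)
        rw [add_sub_cancel_right] at hqG
        exact Submodule.add_mem _
          (Ideal.subset_span (hK.le ⟨poly_mono (by omega) hq, hqG⟩))
          (truncatedProducts_le_ideal _ _ hτ)
      · exact fun f hf => ⟨hf.1, hTG (mem_truncatedProducts_of_mem_span hs hflat hf.2 hf.1)⟩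
    · intro B hB
      refine decomposes_iff_isColumnBasis ?_ hB
      have hle : Poly n (s - 1) ≤ Poly n s := poly_mono (Nat.sub_le s 1)
      rw [← inf_eq_left.mpr hle, inf_assoc, hK, momentKer_eq_inf hst hL.1.2,
        momentKer_eq_inf ((Nat.sub_le s 1).trans hst) hL.1.2, ← inf_assoc, inf_eq_left.mpr hle]
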